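/- Conventions. $\mathbb N=\{1,2,\dots\}$; finite subsets of $\mathbb N$ are written increasingly; $A<B$ means $a<b$ for all $a\in A$, $b\in B$; $A\preceq B$ means that $A$ is an initial segment of $B$; $\mathrm{MAX}(\mathcal F)$ is the set of $A\in\mathcal F$ having no proper extension ($A\preceq B$, $A\ne B$) in $\mathcal F$. Schreier families. For every countable limit ordinal $\alpha$ fix a sequence $(\lambda(\alpha,n))_{n\ge1}$ in $[1,\alpha)$ increasing to $\alpha$. Put $\mathcal S_0=\{\emptyset\}\cup\{\{n\}:n\in\mathbb N\}$; let $\mathcal S_{\gamma+1}$ be the set of all $A=\bigcup_{j=1}^nE_j$ with $E_1<\dots<E_n$ in $\mathcal S_\gamma$ and $n\le\min A$ (where $\min\emptyset=\infty$); and for a limit ordinal $\alpha$ let $\mathcal S_\alpha=\{A:\ A\in\mathcal S_{\lambda(\alpha,k)}\text{ for some }k\le\min A\}$. The sequences are required to satisfy: (1) if $\alpha=\delta+\omega^{\xi}$ with $\xi\ge1$, $\delta\neq0$ and all exponents in the Cantor normal form of $\delta$ at least $\xi$, then $\lambda(\alpha,n)=\delta+\lambda(\omega^{\xi},n)$ for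 all $n$; (2) if $\alpha=\omega^\xi$ with $\xi\ge1$, then $\mathcal S_{\lambda(\alpha,n)}\subset\mathcal S_{\lambda(\alpha,n+1)}$ for all $n$. The metric. For $A\in\mathrm{MAX}(\mathcal S_\alpha)$ define $z_{(\alpha,A)}:\mathbb N\to[0,1]$ recursively: $z_{(0,\{n\})}=e_n$ is the indicator function of $\{n\}$; $z_{(\gamma+1,A)}=\frac1n\sum_{j=1}^nz_{(\gamma,A_j)}$, where $n=\min A$ and $A=\bigcup_{j=1}^nA_j$ is the unique decomposition with $A_1<\dots<A_n$ in $\mathrm{MAX}(\mathcal S_\gamma)$; and $z_{(\alpha,A)}=z_{(\lambda(\alpha,\min A),A)}$ if $\alpha$ is a limit ordinal. For arbitrary $A\in\mathcal S_\alpha$ let $z_{(\alpha,A)}$ be the restriction to $A$ (and $0$ off $A$) of $z_{(\alpha,B)}$ for any $B\in\mathrm{MAX}(\mathcal S_\alpha)$ with $A\preceq B$; this does not depend on $B$. For $A,B\in\mathcal S_\alpha$ with largest common initial segment $C$ put $$d_{1,\alpha}(A,B)=\sum_{a\in A\setminus C}z_{(\alpha,A)}(a)+\sum_{b\in B\setminus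 C}z_{(\alpha,B)}(b).$$ Szlenk index. For a real Banach space $Y$, $\varepsilon>0$ and $K\subset Y^*$ let $K'_\varepsilon$ be the set of all $y^*\in Y^*$ for which there is a sequence $(y_n^*)$ in $K$ with $y_n^*\to y^*$ weak-$*$ and $\|y_n^*-y^*\|>\varepsilon$ for all $n$. Put $K^{(0)}_\varepsilon=K$, $K^{(\beta+1)}_\varepsilon=(K^{(\beta)}_\varepsilon)'_\varepsilon$, $K^{(\gamma)}_\varepsilon=\bigcap_{\beta<\gamma}K^{(\beta)}_\varepsilon$ for limit ordinals $\gamma$, and $\mathrm{Sz}(Y)=\sup_{\varepsilon>0}\sup\{\beta<\omega_1:(B_{Y^*})^{(\beta)}_\varepsilon\ne\emptyset\}$, where $B_{Y^*}$ is the closed unit ball of $Y^*$. Theorem. Let $X$ be a separable real Banach space and let $\alpha$ be a countable ordinal such that $\max(\mathrm{Sz}(X),\mathrm{Sz}(X^*))>\omega^\alpha$. Then $(\mathcal S_\alpha,d_{1,\alpha})$ embeds bi-Lipschitzly into $X$ and into $X^*$: for $Y=X$ and for $Y=X^*$ there are a map $\Phi:\mathcal S_\alpha\to Y$ and constants $0<c\le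 C$ with $$c\,d_{1,\alpha}(A,B)\le\|\Phi(A)-\Phi(B)\|\le C\,d_{1,\alpha}(A,B)\qquad\text{for all }A,B\in\mathcal S_\alpha .$$ -/

import Mathlib

open Set Filter Topology Order Ordinal

noncomputable section

/-! ### Finite sets of natural numbers -/

/-- `A < B`: every element of `A` is smaller than every element of `B`
(in particular `A < ∅` and `∅ < A`). -/
def SetBefore (A B : Finset ℕ) : Prop := ∀ a ∈ A, ∀ b ∈ B, a < b

/-- `A ≼ B`: `A` is an initial segment of `B`, i.e. `B` extends `A`. -/
def IsInitSeg (A B : Finset ℕ) : Prop := A ⊆ B ∧ ∀ a ∈ A, ∀ b ∈ B, b ≤ a → b ∈ A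

/-- `MAX(F)`: the members of `F` that have no proper extension in `F`. -/
def maxMembers (F : Set (Finset ℕ)) : Set (Finset ℕ) :=
  {A | A ∈ F ∧ ∀ B ∈ F, IsInitSeg A B → B = A}

/-- The smallest element of a non-empty finite set. -/
def minElt (A : Finset ℕ) : ℕ := sInf (A : Set ℕ)

/-- `E 0 < E 1 < ... < E (n - 1)` are successive sets with union `A`. -/
def IsBlockDecomp (A : Finset ℕ) (n : ℕ) (E : Fin n → Finset ℕ) : Prop :=
  (∀ i j, i < j → SetBefore (E i) (E j)) ∧ A = Finset.univ.biUnion E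

open Classical in
/-- The largest common initial segment of `A` and `B`. -/
def commonInitSeg (A B : Finset ℕ) : Finset ℕ :=
  A.filter fun a => ∀ b ≤ a, b ∈ A ↔ b ∈ B

theorem isInitSeg_commonInitSeg_iff (A B C : Finset ℕ) :
    IsInitSeg C (commonInitSeg A B) ↔ IsInitSeg C A ∧ IsInitSeg C B := by
  constructor
  · rintro ⟨h1, h2⟩
    have key : ∀ c ∈ C, c ∈ A ∧ ∀ b ≤ c, b ∈ A ↔ b ∈ B := fun c hc => by
      simpa [commonInitSeg] using h1 hc
    have key2 : ∀ c ∈ C, ∀ b ≤ c, b ∈ A → b ∈ C := fun c hc b hbc hb => by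
      refine h2 c hc b ?_ hbc
      simp only [commonInitSeg, Finset.mem_filter]
      exact ⟨hb, fun d hd => (key c hc).2 d (hd.trans hbc)⟩
    refine ⟨⟨fun c hc => (key c hc).1, fun c hc b hb hbc => key2 c hc b hbc hb⟩,
      ⟨fun c hc => ((key c hc).2 c le_rfl).1 (key c hc).1, fun c hc b hb hbc => ?_⟩⟩
    exact key2 c hc b hbc (((key c hc).2 b hbc).2 hb)
  · rintro ⟨⟨hA1, hA2⟩, ⟨hB1, hB2⟩⟩
    refine ⟨fun c hc => ?_, fun c hc b hb hbc => hA2 c hc b ?_ hbc⟩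
    · simp only [commonInitSeg, Finset.mem_filter]
      exact ⟨hA1 hc, fun b hb => ⟨fun h => hB1 (hA2 c hc b h hb), fun h => hA1 (hB2 c hc b h hb)⟩⟩
    · simp only [commonInitSeg, Finset.mem_filter] at hb
      exact hb.1

/-! ### Schreier families -/

/-- The Schreier families `S_α` built from approximating sequences `lam α 1, lam α 2, ...` of the
limit ordinals `α`. The natural numbers start at `1` here, so `0` is in no member of `S_α`. -/
def schreier (lam : Ordinal.{0} → ℕ → Ordinal.{0}) (α : Ordinal.{0}) : Set (Finset ℕ) :=
  Ordinal.limitRecOn (motive := fun _ => Set (Finset ℕ)) α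
    {A | A = ∅ ∨ ∃ n, 1 ≤ n ∧ A = {n}}
    (fun _ F => {A | ∃ (n : ℕ) (E : Fin n → Finset ℕ),
      (∀ a ∈ A, n ≤ a) ∧ IsBlockDecomp A n E ∧ ∀ j, E j ∈ F})
    (fun γ _ F => {A | ∃ k, 1 ≤ k ∧ (∀ a ∈ A, k ≤ a) ∧ ∃ h : lam γ k < γ, A ∈ F (lam γ k) h})

theorem schreier_zero (lam : Ordinal.{0} → ℕ → Ordinal.{0}) :
    schreier lam 0 = {A | A = ∅ ∨ ∃ n, 1 ≤ n ∧ A = {n}} := by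
  simp [schreier]

theorem schreier_add_one (lam : Ordinal.{0} → ℕ → Ordinal.{0}) (γ : Ordinal.{0}) :
    schreier lam (γ + 1) = {A | ∃ (n : ℕ) (E : Fin n → Finset ℕ),
      (∀ a ∈ A, n ≤ a) ∧ IsBlockDecomp A n E ∧ ∀ j, E j ∈ schreier lam γ} := by
  simp [schreier]

theorem schreier_limit (lam : Ordinal.{0} → ℕ → Ordinal.{0}) (γ : Ordinal.{0})
    (hγ : IsSuccLimit γ) (hlam : ∀ n, 1 ≤ n → lam γ n < γ) :
    schreier lam γ =
      {A | ∃ k, 1 ≤ k ∧ (∀ a ∈ A, k ≤ a) ∧ A ∈ schreier lam (lam γ k)} := by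
  ext A
  rw [schreier, Ordinal.limitRecOn_limit _ _ _ _ hγ]
  constructor
  · rintro ⟨k, hk, hA, _, hm⟩
    exact ⟨k, hk, hA, hm⟩
  · rintro ⟨k, hk, hA, hm⟩
    exact ⟨k, hk, hA, hlam k hk, hm⟩

/-- The requirements on the approximating sequences of the countable limit ordinals. -/
structure IsApproxSystem (lam : Ordinal.{0} → ℕ → Ordinal.{0}) : Prop where
  /-- `lam α n` lies in `[1, α)`. -/
  one_le : ∀ α, IsSuccLimit α → α < ω_ 1 → ∀ n, 1 ≤ n → 1 ≤ lam α n
  lt : ∀ α, IsSuccLimit α → α < ω_ 1 → ∀ n, 1 ≤ n → lam α n < α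
  /-- `lam α n` increases to `α`. -/
  mono : ∀ α, IsSuccLimit α → α < ω_ 1 → ∀ m n, 1 ≤ m → m ≤ n → lam α m ≤ lam α n
  cofinal : ∀ α, IsSuccLimit α → α < ω_ 1 → ∀ β < α, ∃ n, 1 ≤ n ∧ β < lam α n
  /-- If the Cantor normal form of `α` is `δ + ω ^ ξ` with `ξ ≥ 1` and `δ ≠ 0` (all exponents in
  `δ` are at least `ξ`, i.e. `ω ^ ξ` divides `δ`), then `lam α n = δ + lam (ω ^ ξ) n`. -/
  cantor : ∀ δ ξ : Ordinal.{0}, 1 ≤ ξ → δ ≠ 0 → ω ^ ξ ∣ δ → δ + ω ^ ξ < ω_ 1 →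
    ∀ n, 1 ≤ n → lam (δ + ω ^ ξ) n = δ + lam (ω ^ ξ) n
  /-- For the powers of `ω` the approximating Schreier families increase. -/
  subset : ∀ ξ : Ordinal.{0}, 1 ≤ ξ → ω ^ ξ < ω_ 1 → ∀ n, 1 ≤ n →
    schreier lam (lam (ω ^ ξ) n) ⊆ schreier lam (lam (ω ^ ξ) (n + 1))

/-! ### Repeated averages -/

/-- `A = E 0 ∪ ... ∪ E (n - 1)` with `E 0 < ... < E (n - 1)` in `MAX(F)` and `n = min A`. -/
def IsMaxDecomp (F : Set (Finset ℕ)) (A : Finset ℕ)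
    (p : Σ n : ℕ, Fin n → Finset ℕ) : Prop :=
  A.Nonempty ∧ p.1 = minElt A ∧ IsBlockDecomp A p.1 p.2 ∧ ∀ j, p.2 j ∈ maxMembers F

open Classical in
/-- The repeated average `z_(α, A)` for `A ∈ MAX(S_α)`, as a function on `ℕ`: `z_(0, {n})` is the
unit vector `e_n`; `z_(γ + 1, A) = (1 / n) ∑ j, z_(γ, A_j)` for the decomposition of `A` into
`n = min A` successive maximal members `A_j` of `S_γ`;
and `z_(γ, A) = z_(lam γ (min A), A)` for limit ordinals `γ`. -/
def maxAverage (lam : Ordinal.{0} → ℕ → Ordinal.{0}) (α : Ordinal.{0}) :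
    Finset ℕ → ℕ → ℝ :=
  Ordinal.limitRecOn (motive := fun _ => Finset ℕ → ℕ → ℝ) α
    (fun A a => if A = {a} then 1 else 0)
    (fun γ z A a =>
      if h : ∃ p, IsMaxDecomp (schreier lam γ) A p then
        (1 / (h.choose.1 : ℝ)) * ∑ j, z (h.choose.2 j) a
      else 0)
    (fun γ _ z A a =>
      if h : lam γ (minElt A) < γ then z (lam γ (minElt A)) h A a else 0)

open Classical in
/-- `z_(α, A)` for arbitrary `A ∈ S_α`: the restriction to `A` of `z_(α, B)`, where `B` is a
maximal extension of `A` in `S_α` (the result does not depend on `B`). -/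
def repeatedAverage (lam : Ordinal.{0} → ℕ → Ordinal.{0}) (α : Ordinal.{0})
    (A : Finset ℕ) (a : ℕ) : ℝ :=
  if h : a ∈ A ∧ ∃ B ∈ maxMembers (schreier lam α), IsInitSeg A B then
    maxAverage lam α h.2.choose a
  else 0

/-- The weighted tree distance `d_(1,α)` on `S_α`. -/
def schreierDist (lam : Ordinal.{0} → ℕ → Ordinal.{0}) (α : Ordinal.{0})
    (A B : schreier lam α) : ℝ :=
  ∑ a ∈ A.1 \ commonInitSeg A.1 B.1, repeatedAverage lam α A.1 a +
    ∑ b ∈ B.1 \ commonInitSeg A.1 B.1, repeatedAverage lam α B.1 b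

/-- `(S_α, d_(1,α))` embeds bi-Lipschitzly into the normed space `Y`. -/
def SchreierBiLipschitzEmbeds (lam : Ordinal.{0} → ℕ → Ordinal.{0}) (α : Ordinal.{0})
    (Y : Type*) [NormedAddCommGroup Y] : Prop :=
  ∃ (Φ : schreier lam α → Y) (c C : ℝ), 0 < c ∧ ∀ A B : schreier lam α,
    c * schreierDist lam α A B ≤ ‖Φ A - Φ B‖ ∧ ‖Φ A - Φ B‖ ≤ C * schreierDist lam α A B

/-! ### The Szlenk index -/

section Szlenk

variable (X : Type*) [NormedAddCommGroup X] [NormedSpace ℝ X]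

/-- The derived set `K'_ε`: all weak-* limits `f` of sequences in `K` whose members have norm
distance greater than `ε` from `f`. -/
def szlenkDeriv (ε : ℝ) (K : Set (StrongDual ℝ X)) : Set (StrongDual ℝ X) :=
  {f | ∃ u : ℕ → StrongDual ℝ X, (∀ n, u n ∈ K) ∧
    Tendsto (fun n => StrongDual.toWeakDual (u n)) atTop (𝓝 (StrongDual.toWeakDual f)) ∧
    ∀ n, ε < ‖u n - f‖}

/-- The iterated derived sets `K^(α)_ε`. -/
def szlenkIter (ε : ℝ) (K : Set (StrongDual ℝ X)) (α : Ordinal.{0}) : Set (StrongDual ℝ X) :=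
  Ordinal.limitRecOn (motive := fun _ => Set (StrongDual ℝ X)) α K
    (fun _ L => szlenkDeriv X ε L)
    (fun γ _ L => ⋂ (β : Ordinal.{0}) (h : β < γ), L β h)

theorem szlenkIter_zero (ε : ℝ) (K : Set (StrongDual ℝ X)) : szlenkIter X ε K 0 = K := by
  simp [szlenkIter]

theorem szlenkIter_add_one (ε : ℝ) (K : Set (StrongDual ℝ X)) (α : Ordinal.{0}) :
    szlenkIter X ε K (α + 1) = szlenkDeriv X ε (szlenkIter X ε K α) := by
  simp [szlenkIter]

theorem szlenkIter_limit (ε : ℝ) (K : Set (StrongDual ℝ X)) (γ : Ordinal.{0})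
    (hγ : IsSuccLimit γ) : szlenkIter X ε K γ = ⋂ β < γ, szlenkIter X ε K β := by
  rw [szlenkIter, Ordinal.limitRecOn_limit _ _ _ _ hγ]
  rfl

/-- The Szlenk index `Sz(X)`: the supremum over `ε > 0` of
`η(ε) = sup {α < ω₁ : K^(α)_ε ≠ ∅}`, where `K` is the closed unit ball of `X*`. -/
def szlenkIndex : Ordinal.{0} :=
  ⨆ ε : {ε : ℝ // 0 < ε},
    sSup {α : Ordinal.{0} | α < ω_ 1 ∧
      (szlenkIter X (ε : ℝ) (Metric.closedBall (0 : StrongDual ℝ X) 1) α).Nonempty}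

end Szlenk

end

/-! ### Initial segments and successive blocks -/

/-! Ordered by end-extension, `S_α` is a tree of rank at most `ω ^ α`. If `Sz(Z) > ω ^ α`, then for
some `ε` the derived set of order `ω ^ α` of the dual ball is non-empty, and the tree can be mapped
into the derived sets: each node `A` receives a functional `g A` in the derived set of order `ρ A`,
where `ρ` is the rank. Nodes are treated one by one, initial segments before extensions. The new `g
A` is weak-* close to the functional of its predecessor on all points chosen so far, and a new point
`x A` of the ball lies in the kernel of all earlier functionals while `g A (x A) ≥ ε / 6`. The
resulting matrix is almost triangular: `g A (x D)` is bounded below if `D` is a non-empty initial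
segment of `A` and is nearly zero for all other non-empty `D` (`exists_tree_sequence`,
`exists_almost_triangular`).

The embedding is `Φ A = ∑ z_A(a) y(A up to a)` over `a ∈ A`. The averages are coherent, so in `Φ A -
Φ B` the common initial segment cancels. The triangle inequality bounds the rest from above, and a
functional that is large on one branch and small on the other bounds it from below
(`schreierBiLipschitzEmbeds_of_tree`).

The matrix serves twice: the points `x` are tested by the functionals, and the functionals by the
points. With `Z = X` this gives embeddings into `X` and `X*`. With `Z = X*` the functionals lie in
`X**`; Goldstine's theorem replaces them by vectors of `X`, and the same two embeddings result.

The combinatorial input is that `S_(lam γ n)` increases with `n` for every limit `γ`, not only for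
powers of `ω`. Then membership of `A` in `S_γ` is decided at the index `min A`, which yields both
the rank bound and the coherence of the averages. It follows from a composition formula for `S_(δ +
β)` (`schreier_add_eq_conv`). -/

theorem IsInitSeg.refl (A : Finset ℕ) : IsInitSeg A A := ⟨subset_rfl, fun _ _ _ h _ => h⟩

theorem isInitSeg_empty (A : Finset ℕ) : IsInitSeg ∅ A := ⟨by simp, by simp⟩

theorem IsInitSeg.trans {A B C : Finset ℕ} (h : IsInitSeg A B) (h' : IsInitSeg B C) :
    IsInitSeg A C :=
  ⟨h.1.trans h'.1, fun a ha c hc hca => h.2 a ha c (h'.2 a (h.1 ha) c hc hca) hca⟩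

theorem IsInitSeg.total {A B C : Finset ℕ} (hA : IsInitSeg A C) (hB : IsInitSeg B C) :
    IsInitSeg A B ∨ IsInitSeg B A := by
  by_cases h : A ⊆ B
  · exact Or.inl ⟨h, fun a ha b hb hba => hA.2 a ha b (hB.1 hb) hba⟩
  · obtain ⟨a, haA, haB⟩ := Finset.not_subset.1 h
    refine Or.inr ⟨fun b hb => hA.2 a haA b (hB.1 hb) ?_,
      fun b hb a' ha' hab => hB.2 b hb a' (hA.1 ha') hab⟩
    by_contra hlt
    exact haB (hB.2 b hb a (hA.1 haA) (by omega))

theorem isInitSeg_insert {A : Finset ℕ} {k : ℕ} (hk : ∀ a ∈ A, a < k) :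
    IsInitSeg A (insert k A) := by
  refine ⟨Finset.subset_insert _ _, fun a ha b hb hba => ?_⟩
  rcases Finset.mem_insert.1 hb with rfl | hb
  · exact absurd (hk a ha) (by omega)
  · exact hb

theorem minElt_mem {A : Finset ℕ} (h : A.Nonempty) : minElt A ∈ A := by
  have : minElt A ∈ (A : Set ℕ) := Nat.sInf_mem (by simpa using h)
  simpa using this

theorem minElt_le {A : Finset ℕ} {a : ℕ} (h : a ∈ A) : minElt A ≤ a :=
  Nat.sInf_le (by simpa using h)

theorem minElt_eq_of_agree {A B : Finset ℕ} {a : ℕ} (ha : a ∈ A)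
    (h : ∀ b ≤ a, b ∈ A ↔ b ∈ B) : minElt A = minElt B := by
  have haB : a ∈ B := (h a le_rfl).1 ha
  have h1 : minElt A ∈ B := (h _ (minElt_le ha)).1 (minElt_mem ⟨a, ha⟩)
  have h2 : minElt B ∈ A := (h _ (minElt_le haB)).2 (minElt_mem ⟨a, haB⟩)
  exact le_antisymm (minElt_le h2) (minElt_le h1)

theorem IsInitSeg.minElt_eq {A B : Finset ℕ} (h : IsInitSeg A B) (hA : A.Nonempty) :
    minElt A = minElt B := by
  obtain ⟨a, ha⟩ := hA
  exact minElt_eq_of_agree ha fun b hb => ⟨fun h' => h.1 h', fun h' => h.2 a ha b h' hb⟩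

/-- The part of `A` up to `a`. -/
def upTo (A : Finset ℕ) (a : ℕ) : Finset ℕ := A.filter (· ≤ a)

theorem mem_upTo {A : Finset ℕ} {a b : ℕ} : b ∈ upTo A a ↔ b ∈ A ∧ b ≤ a := by simp [upTo]

theorem upTo_isInitSeg (A : Finset ℕ) (a : ℕ) : IsInitSeg (upTo A a) A :=
  ⟨fun _ hb => (mem_upTo.1 hb).1,
    fun _ hb _ hc hcb => mem_upTo.2 ⟨hc, hcb.trans (mem_upTo.1 hb).2⟩⟩

/-- The unions of `n` successive members of `F`. -/
def Blocks (F : Set (Finset ℕ)) : ℕ → Set (Finset ℕ)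
  | 0 => {∅}
  | n + 1 => {A | ∃ E ∈ F, ∃ A' ∈ Blocks F n, SetBefore E A' ∧ A = E ∪ A'}

theorem mem_blocks_iff {F : Set (Finset ℕ)} {n : ℕ} {A : Finset ℕ} :
    A ∈ Blocks F n ↔ ∃ E : Fin n → Finset ℕ, IsBlockDecomp A n E ∧ ∀ j, E j ∈ F := by
  induction n generalizing A with
  | zero =>
    simp only [Blocks, mem_singleton_iff, IsBlockDecomp]
    constructor
    · rintro rfl
      exact ⟨fun _ => ∅, ⟨fun i => i.elim0, by ext; simp⟩, fun i => i.elim0⟩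
    · rintro ⟨E, ⟨_, h⟩, _⟩
      rw [h]; ext; simp
  | succ n ih =>
    constructor
    · rintro ⟨E, hE, A', hA', hb, rfl⟩
      obtain ⟨G, ⟨hG1, hG2⟩, hGF⟩ := ih.1 hA'
      refine ⟨Fin.cons E G, ⟨?_, ?_⟩, ?_⟩
      · intro i j hij
        induction j using Fin.cases with
        | zero => exact absurd hij (by simp)
        | succ j =>
          induction i using Fin.cases with
          | zero =>
            intro a ha b hb'
            exact hb a (by simpa using ha) b
              (by rw [hG2]; exact Finset.mem_biUnion.2 ⟨j, by simp, by simpa using hb'⟩)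
          | succ i => simpa using hG1 i j (by simpa using hij)
      · ext x
        simp [hG2, Fin.exists_fin_succ]
      · intro j
        induction j using Fin.cases with
        | zero => simpa
        | succ j => simpa using hGF j
    · rintro ⟨E, ⟨h1, h2⟩, hF⟩
      refine ⟨E 0, hF 0, Finset.univ.biUnion (fun j : Fin n => E j.succ),
        ih.2 ⟨fun j => E j.succ, ⟨fun i j hij => h1 _ _ (by simpa using hij), rfl⟩,
          fun j => hF _⟩, ?_, ?_⟩
      · intro a ha b hb
        obtain ⟨j, _, hj⟩ := Finset.mem_biUnion.1 hb
        exact h1 0 j.succ (Fin.succ_pos j) a ha b hj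
      · rw [h2]; ext x
        simp [Fin.exists_fin_succ]

theorem blocks_mono_succ {F : Set (Finset ℕ)} (h : ∅ ∈ F) (n : ℕ) :
    Blocks F n ⊆ Blocks F (n + 1) :=
  fun A hA => ⟨∅, h, A, hA, by simp [SetBefore], by simp⟩

theorem blocks_mono {F : Set (Finset ℕ)} (h : ∅ ∈ F) {m n : ℕ} (hmn : m ≤ n) :
    Blocks F m ⊆ Blocks F n :=
  monotone_nat_of_le_succ (fun n => blocks_mono_succ h n) hmn

theorem empty_mem_blocks {F : Set (Finset ℕ)} (h : ∅ ∈ F) (n : ℕ) : ∅ ∈ Blocks F n :=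
  blocks_mono h (Nat.zero_le n) (by simp [Blocks])

theorem mem_blocks_one {F : Set (Finset ℕ)} {A : Finset ℕ} (hA : A ∈ F) : A ∈ Blocks F 1 :=
  ⟨A, hA, ∅, by simp [Blocks], by simp [SetBefore], by simp⟩

/-- The properties shared by all Schreier families. -/
structure IsSchreierLike (F : Set (Finset ℕ)) : Prop where
  singleton : ∀ n, 1 ≤ n → {n} ∈ F
  down : ∀ A ∈ F, ∀ B ⊆ A, B ∈ F
  pos : ∀ A ∈ F, ∀ a ∈ A, 1 ≤ a
  /-- Whether a non-empty set can be end-extended by one point does not depend on the point. -/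
  insert_of_insert : ∀ E : Finset ℕ, E.Nonempty → ∀ k l, (∀ a ∈ E, a < k) → (∀ a ∈ E, a < l) →
    insert l E ∈ F → insert k E ∈ F

namespace IsSchreierLike

variable {F : Set (Finset ℕ)}

theorem empty_mem (hF : IsSchreierLike F) : ∅ ∈ F :=
  hF.down {1} (hF.singleton 1 le_rfl) ∅ (by simp)

theorem insert_mem_of_not_max (hF : IsSchreierLike F) {E : Finset ℕ} (hE : E ∈ F)
    (hne : E.Nonempty) (hmax : E ∉ maxMembers F) {k : ℕ} (hk : ∀ a ∈ E, a < k) :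
    insert k E ∈ F := by
  simp only [maxMembers, mem_ofPred_eq, not_and, not_forall] at hmax
  obtain ⟨B, hB, hEB, hne'⟩ := hmax hE
  obtain ⟨b, hbB, hbE⟩ : ∃ b ∈ B, b ∉ E := by
    by_contra! h
    exact hne' (Finset.Subset.antisymm h hEB.1)
  refine hF.insert_of_insert E hne k b hk (fun a ha => ?_)
    (hF.down B hB _ (Finset.insert_subset hbB hEB.1))
  by_contra h
  exact hbE (hEB.2 a ha b hbB (by omega))

theorem blocks_down (hF : ∀ A ∈ F, ∀ B ⊆ A, B ∈ F) (n : ℕ) :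
    ∀ A ∈ Blocks F n, ∀ B ⊆ A, B ∈ Blocks F n := by
  induction n with
  | zero =>
    intro A hA B hB
    simp only [Blocks, mem_singleton_iff] at hA ⊢
    subst hA
    exact Finset.subset_empty.1 hB
  | succ n ih =>
    rintro _ ⟨E, hE, A', hA', hb, rfl⟩ B hB
    refine ⟨E ∩ B, hF E hE _ Finset.inter_subset_left, A' ∩ B,
      ih A' hA' _ Finset.inter_subset_left,
      fun a ha b hb' => hb a (Finset.mem_inter.1 ha).1 b (Finset.mem_inter.1 hb').1, ?_⟩
    rw [← Finset.union_inter_distrib_right]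
    exact (Finset.inter_eq_right.2 hB).symm

theorem blocks_pos (hF : ∀ A ∈ F, ∀ a ∈ A, 1 ≤ a) (n : ℕ) :
    ∀ A ∈ Blocks F n, ∀ a ∈ A, 1 ≤ a := by
  induction n with
  | zero =>
    intro A hA
    simp only [Blocks, mem_singleton_iff] at hA
    simp [hA]
  | succ n ih =>
    rintro _ ⟨E, hE, A', hA', hb, rfl⟩ a ha
    rcases Finset.mem_union.1 ha with h | h
    · exact hF E hE a h
    · exact ih A' hA' a h

/-- The exchanged point is the last one. If it lies in the first block, the tail is empty and the
exchange happens in `F`; otherwise it happens in the tail, where a tail consisting of that point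
alone becomes the singleton `{k}`. -/
theorem blocks_insert (hF : IsSchreierLike F) (n : ℕ) :
    ∀ E : Finset ℕ, E.Nonempty → ∀ k l, (∀ a ∈ E, a < k) → (∀ a ∈ E, a < l) →
      insert l E ∈ Blocks F n → insert k E ∈ Blocks F n := by
  induction n with
  | zero => intro E _ k l _ _ h; simp [Blocks] at h
  | succ n ih =>
    rintro E hne k l hk hl ⟨G, hG, A', hA', hb, heq⟩
    have hlE : l ∉ E := fun h => lt_irrefl _ (hl l h)
    have hmem : ∀ x, (x = l ∨ x ∈ E) ↔ (x ∈ G ∨ x ∈ A') := fun x => by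
      rw [← Finset.mem_insert, heq, Finset.mem_union]
    have hkpos : 1 ≤ k := by
      obtain ⟨a, ha⟩ := hne
      have := hk a ha
      omega
    by_cases hlG : l ∈ G
    · have hA0 : A' = ∅ := by
        refine Finset.eq_empty_of_forall_notMem fun x hx => ?_
        have h1 := hb l hlG x hx
        rcases (hmem x).2 (Or.inr hx) with rfl | h
        · exact lt_irrefl _ h1
        · exact absurd (hl x h) (by omega)
      subst hA0
      have : insert l E = G := by simpa using heq
      exact blocks_mono hF.empty_mem (by omega)
        (mem_blocks_one (hF.insert_of_insert E hne k l hk hl (this ▸ hG)))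
    · have hlA : l ∈ A' := by
        rcases (hmem l).1 (Or.inl rfl) with h | h
        · exact absurd h hlG
        · exact h
      have hGE : ∀ x ∈ G, x ∈ E := fun x hx => by
        rcases (hmem x).2 (Or.inl hx) with rfl | h
        · exact absurd hx hlG
        · exact h
      have hAE : ∀ x ∈ A'.erase l, x ∈ E := fun x hx => by
        rcases (hmem x).2 (Or.inr (Finset.mem_of_mem_erase hx)) with rfl | h
        · simp at hx
        · exact h
      refine ⟨G, hG, insert k (A'.erase l), ?_, ?_, ?_⟩
      · by_cases hne2 : (A'.erase l).Nonempty
        · exact ih _ hne2 k l (fun a ha => hk a (hAE a ha)) (fun a ha => hl a (hAE a ha))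
            (by rwa [Finset.insert_erase hlA])
        · rw [Finset.not_nonempty_iff_eq_empty.1 hne2]
          obtain _ | n := n
          · simp [Blocks] at hA'; simp [hA'] at hlA
          · exact blocks_mono hF.empty_mem (by omega)
              (mem_blocks_one (by simpa using hF.singleton k hkpos))
      · intro a ha b hb'
        rcases Finset.mem_insert.1 hb' with rfl | h
        · exact hk a (hGE a ha)
        · exact hb a ha b (Finset.mem_of_mem_erase h)
      · ext x
        have := hmem x
        simp only [Finset.mem_insert, Finset.mem_union, Finset.mem_erase]
        by_cases hxl : x = l
        · subst hxl; simp [hlG, hlE]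
        · simp only [hxl, false_or] at this
          simp [hxl, this]; tauto

end IsSchreierLike

open Classical in
/-- The largest initial segment of `A` that belongs to the hereditary family `F`. -/
noncomputable def headSeg (F : Set (Finset ℕ)) (A : Finset ℕ) : Finset ℕ := A.filter fun a => upTo A a ∈ F

/-! ### Greedy splitting into successive members of a family. -/

section headSeg

variable {F : Set (Finset ℕ)} {A B : Finset ℕ}

theorem mem_headSeg {a : ℕ} : a ∈ headSeg F A ↔ a ∈ A ∧ upTo A a ∈ F := by simp [headSeg]

theorem headSeg_subset : headSeg F A ⊆ A := fun _ h => (mem_headSeg.1 h).1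

theorem headSeg_isInitSeg (hF : IsSchreierLike F) : IsInitSeg (headSeg F A) A := by
  refine ⟨headSeg_subset, fun a ha b hb hba => mem_headSeg.2 ⟨hb, ?_⟩⟩
  exact hF.down _ (mem_headSeg.1 ha).2 _ fun c hc =>
    mem_upTo.2 ⟨(mem_upTo.1 hc).1, (mem_upTo.1 hc).2.trans hba⟩

theorem headSeg_mem (hF : IsSchreierLike F) : headSeg F A ∈ F := by
  by_cases h : (headSeg F A).Nonempty
  · have hm := Finset.max'_mem _ h
    refine hF.down _ (mem_headSeg.1 hm).2 _ fun c hc => ?_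
    exact mem_upTo.2 ⟨headSeg_subset hc, Finset.le_max' _ _ hc⟩
  · rw [Finset.not_nonempty_iff_eq_empty.1 h]
    exact hF.empty_mem

theorem subset_headSeg {E : Finset ℕ} (hF : IsSchreierLike F) (hE : E ∈ F)
    (h : IsInitSeg E A) : E ⊆ headSeg F A := fun a ha =>
  mem_headSeg.2 ⟨h.1 ha, hF.down E hE _ fun b hb =>
    h.2 a ha b (mem_upTo.1 hb).1 (mem_upTo.1 hb).2⟩

/-- Once a set has left `F`, the cut lies inside it, so further extension does not move the head. -/
theorem headSeg_eq_of_isInitSeg (hF : IsSchreierLike F) (hAB : IsInitSeg A B) (hA : A ∉ F) :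
    headSeg F A = headSeg F B := by
  refine Finset.Subset.antisymm
    (subset_headSeg hF (headSeg_mem hF) ((headSeg_isInitSeg hF).trans hAB)) ?_
  refine subset_headSeg hF (headSeg_mem hF) ?_
  rcases (headSeg_isInitSeg (A := B) hF).total hAB with h | h
  · exact h
  · exact absurd (hF.down _ (headSeg_mem hF) _ h.1) hA

theorem headSeg_before_sdiff (hF : IsSchreierLike F) :
    SetBefore (headSeg F A) (A \ headSeg F A) := by
  intro a ha b hb
  rw [Finset.mem_sdiff] at hb
  by_contra h
  exact hb.2 ((headSeg_isInitSeg hF).2 a ha b hb.1 (by omega))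

/-- The greedy head contains the first block of any decomposition, so what remains is covered by the
other blocks. -/
theorem sdiff_headSeg_mem_blocks (hF : IsSchreierLike F) {n : ℕ} (hA : A ∈ Blocks F (n + 1)) :
    A \ headSeg F A ∈ Blocks F n := by
  obtain ⟨E, hE, A', hA', hb, rfl⟩ := hA
  refine IsSchreierLike.blocks_down hF.down n A' hA' _ fun x hx => ?_
  rw [Finset.mem_sdiff, Finset.mem_union] at hx
  rcases hx.1 with h | h
  · refine absurd (subset_headSeg hF hE ⟨Finset.subset_union_left, fun a ha b hb' hba => ?_⟩ h) hx.2
    rcases Finset.mem_union.1 hb' with h' | h'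
    · exact h'
    · exact absurd (hb a ha b h') (by omega)
  · exact h

theorem insert_headSeg_notMem (hF : IsSchreierLike F) (hA : A ∉ F) :
    insert (minElt (A \ headSeg F A)) (headSeg F A) ∉ F := by
  have hne : (A \ headSeg F A).Nonempty := by
    rw [Finset.sdiff_nonempty]
    exact fun h => hA (Finset.Subset.antisymm headSeg_subset h ▸ headSeg_mem hF)
  have hm := minElt_mem hne
  set m := minElt (A \ headSeg F A) with hmdef
  rw [Finset.mem_sdiff] at hm
  intro h
  refine hm.2 (subset_headSeg hF h ⟨Finset.insert_subset hm.1 headSeg_subset, ?_⟩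
    (Finset.mem_insert_self _ _))
  intro a ha b hb hba
  rcases Finset.mem_insert.1 ha with rfl | ha
  · by_cases hbh : b ∈ headSeg F A
    · exact Finset.mem_insert_of_mem hbh
    · have := minElt_le (Finset.mem_sdiff.2 ⟨hb, hbh⟩)
      rw [← hmdef] at this
      have : b = m := by omega
      simp [this]
  · exact Finset.mem_insert_of_mem ((headSeg_isInitSeg hF).2 a ha b hb hba)

end headSeg

/-- The greedy blocks are the required ones: a non-maximal head could absorb the next point of `A`,
contrary to the choice of the head. If `A` is itself in `F` while further blocks are available, a
singleton block could be appended. -/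
theorem mem_blocks_maxMembers {F : Set (Finset ℕ)} (hF : IsSchreierLike F) (n : ℕ)
    (A : Finset ℕ) (hA : A ∈ Blocks F n)
    (hmax : ∀ k, 1 ≤ k → (∀ a ∈ A, a < k) → insert k A ∉ Blocks F n) :
    A ∈ Blocks (maxMembers F) n := by
  induction n generalizing A with
  | zero => exact hA
  | succ n ih =>
    obtain ⟨K, hK1, hKA⟩ : ∃ K, 1 ≤ K ∧ ∀ a ∈ A, a < K :=
      ⟨A.sup id + 1, by omega, fun a ha => Nat.lt_succ_of_le (Finset.le_sup (f := id) ha)⟩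
    by_cases hAF : A ∈ F
    · have hAne : A.Nonempty := by
        rw [Finset.nonempty_iff_ne_empty]
        rintro rfl
        exact hmax 1 le_rfl (by simp) (blocks_mono hF.empty_mem (by omega)
          (mem_blocks_one (by simpa using hF.singleton 1 le_rfl)))
      have hAmax : A ∈ maxMembers F := by
        by_contra h
        exact hmax K hK1 hKA (blocks_mono hF.empty_mem (by omega)
          (mem_blocks_one (hF.insert_mem_of_not_max hAF hAne h hKA)))
      obtain _ | n := n
      · exact mem_blocks_one hAmax
      · refine absurd ?_ (hmax K hK1 hKA)
        refine ⟨A, hAF, {K}, blocks_mono hF.empty_mem (by omega)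
          (mem_blocks_one (hF.singleton K hK1)), by simpa [SetBefore] using hKA, ?_⟩
        ext x; simp
    · have htail := sdiff_headSeg_mem_blocks hF hA
      have hunion : headSeg F A ∪ (A \ headSeg F A) = A :=
        Finset.union_sdiff_of_subset headSeg_subset
      have hne : (A \ headSeg F A).Nonempty := by
        rw [Finset.sdiff_nonempty]
        exact fun h => hAF (Finset.Subset.antisymm headSeg_subset h ▸ headSeg_mem hF)
      have hmem := minElt_mem hne
      have hnot := insert_headSeg_notMem hF hAF
      refine ⟨headSeg F A, ?_, A \ headSeg F A, ih _ htail ?_, headSeg_before_sdiff hF,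
        hunion.symm⟩
      · by_contra h
        by_cases hhne : (headSeg F A).Nonempty
        · exact hnot (hF.insert_mem_of_not_max (headSeg_mem hF) hhne h
            fun a ha => headSeg_before_sdiff hF a ha _ hmem)
        · rw [Finset.not_nonempty_iff_eq_empty.1 hhne] at hnot
          refine hnot ?_
          have h1 := IsSchreierLike.blocks_pos hF.pos _ A hA _ (Finset.mem_sdiff.1 hmem).1
          simpa [Finset.not_nonempty_iff_eq_empty.1 hhne] using hF.singleton _ h1
      · intro k hk hkA h
        have hkH : ∀ a ∈ headSeg F A, a < k := fun a ha =>
          (headSeg_before_sdiff hF a ha _ hmem).trans (hkA _ hmem)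
        refine hmax k hk ?_ ⟨headSeg F A, headSeg_mem hF, _, h, ?_, ?_⟩
        · intro a ha
          rw [← hunion, Finset.mem_union] at ha
          exact ha.elim (hkH a) (hkA a)
        · intro a ha b hb
          rcases Finset.mem_insert.1 hb with rfl | hb
          · exact hkH a ha
          · exact headSeg_before_sdiff hF a ha b hb
        · rw [Finset.union_insert, hunion]

/-! ### Ranks -/

/-- `F`, ordered by end-extension, carries a strictly decreasing rank bounded by `o`. -/
def HasRank (F : Set (Finset ℕ)) (o : Ordinal.{0}) : Prop :=
  ∃ ρ : Finset ℕ → Ordinal.{0}, ρ ∅ ≤ o ∧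
    ∀ A ∈ F, ∀ B ∈ F, IsInitSeg A B → A ≠ B → ρ B < ρ A

theorem HasRank.exists_maxMembers {F : Set (Finset ℕ)} {o : Ordinal.{0}} (h : HasRank F o)
    {A : Finset ℕ} (hA : A ∈ F) : ∃ B ∈ maxMembers F, IsInitSeg A B := by
  obtain ⟨ρ, -, hρ⟩ := h
  obtain ⟨B, ⟨hB, hAB⟩, hmin⟩ := WellFounded.has_min (InvImage.wf ρ Ordinal.lt_wf)
    {B | B ∈ F ∧ IsInitSeg A B} ⟨A, hA, IsInitSeg.refl A⟩
  refine ⟨B, ⟨hB, fun D hD hBD => ?_⟩, hAB⟩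
  by_contra hne
  exact hmin D ⟨hD, hAB.trans hBD⟩ (hρ B hB D hD hBD (Ne.symm hne))

/-- While the first block is growing, `n` further blocks are in reserve, whence `o * n + ρ A`.
Afterwards the head is frozen and the rank of the tail counts; a non-empty tail has rank below `o *
n`, so the passage between the regimes is also a strict descent. -/
theorem HasRank.blocks {F : Set (Finset ℕ)} {o : Ordinal.{0}} (hF : IsSchreierLike F)
    (h : HasRank F o) (n : ℕ) : HasRank (Blocks F n) (o * n) := by
  classical
  induction n with
  | zero =>
    refine ⟨fun _ => 0, by simp, ?_⟩
    rintro A hA B hB - hne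
    simp only [Blocks, mem_singleton_iff] at hA hB
    exact absurd (hA.trans hB.symm) hne
  | succ n ih =>
    obtain ⟨ρ, hρ0, hρ⟩ := h
    obtain ⟨τ, hτ0, hτ⟩ := ih
    have hempty := empty_mem_blocks hF.empty_mem n
    have key : ∀ A ∈ Blocks F n, A ≠ ∅ → τ A < o * n := fun A hA hne =>
      (hτ ∅ hempty A hA (isInitSeg_empty A) hne.symm).trans_le hτ0
    refine ⟨fun A => if A ∈ F then o * n + ρ A else τ (A \ headSeg F A), ?_, ?_⟩
    · simp only [hF.empty_mem, if_true]
      rw [Nat.cast_succ, mul_add, mul_one]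
      gcongr
    · intro A hA B hB hAB hne
      by_cases hBF : B ∈ F
      · have hAF : A ∈ F := hF.down B hBF A hAB.1
        simp only [hAF, hBF, if_true]
        exact (add_lt_add_iff_left _).2 (hρ A hAF B hBF hAB hne)
      · have hBne : B \ headSeg F B ≠ ∅ := by
          intro h
          rw [Finset.sdiff_eq_empty_iff_subset] at h
          exact hBF (Finset.Subset.antisymm headSeg_subset h ▸ headSeg_mem hF)
        by_cases hAF : A ∈ F
        · simp only [hAF, hBF, if_true, if_false]
          exact (key _ (sdiff_headSeg_mem_blocks hF hB) hBne).trans_le le_self_add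
        · simp only [hAF, hBF, if_false]
          have heq := headSeg_eq_of_isInitSeg hF hAB hAF
          refine hτ _ (sdiff_headSeg_mem_blocks hF hA) _ (sdiff_headSeg_mem_blocks hF hB) ?_ ?_
          · rw [heq]
            refine ⟨Finset.sdiff_subset_sdiff hAB.1 subset_rfl, fun a ha b hb hba => ?_⟩
            rw [Finset.mem_sdiff] at ha hb ⊢
            exact ⟨hAB.2 a ha.1 b hb.1 hba, hb.2⟩
          · intro h
            apply hne
            rw [← Finset.union_sdiff_of_subset (headSeg_subset (F := F) (A := A)), h, heq,
              Finset.union_sdiff_of_subset headSeg_subset]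

/-- Non-empty comparable sets have the same minimum, so away from the root the tree is a disjoint
union of subtrees, each ranked separately strictly below `o`. -/
theorem HasRank.of_fibers {F : Set (Finset ℕ)} {o : Ordinal.{0}} {G : ℕ → Set (Finset ℕ)}
    {p : ℕ → Ordinal.{0}} (hG : ∀ n, 1 ≤ n → HasRank (G n) (p n)) (hp : ∀ n, 1 ≤ n → p n ≤ o)
    (h0 : ∀ n, 1 ≤ n → ∅ ∈ G n)
    (hF : ∀ A ∈ F, A.Nonempty → 1 ≤ minElt A ∧ A ∈ G (minElt A)) : HasRank F o := by
  classical
  choose! ρ hρ0 hρ using hG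
  refine ⟨fun A => if A = ∅ then o else ρ (minElt A) A, by simp, fun A hA B hB hAB hne => ?_⟩
  by_cases hA0 : A = ∅
  · have hB0 : B ≠ ∅ := fun h => hne (hA0.trans h.symm)
    obtain ⟨h1, hBG⟩ := hF B hB (Finset.nonempty_iff_ne_empty.2 hB0)
    simp only [hA0, hB0, if_true, if_false]
    exact (hρ _ h1 ∅ (h0 _ h1) B hBG (isInitSeg_empty B) hB0.symm).trans_le
      ((hρ0 _ h1).trans (hp _ h1))
  · have hAne := Finset.nonempty_iff_ne_empty.2 hA0
    have hBne : B.Nonempty := hAne.mono hAB.1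
    obtain ⟨h1, hAG⟩ := hF A hA hAne
    obtain ⟨-, hBG⟩ := hF B hB hBne
    have hm := hAB.minElt_eq hAne
    simp only [hA0, hBne.ne_empty, if_false]
    rw [← hm] at hBG ⊢
    exact hρ _ h1 A hAG B hBG hAB hne

/-! ### Composition of families -/

open Classical in
/-- The part of `A` lying between the mark `m` and the next mark in `M`. -/
noncomputable def markBlock (A M : Finset ℕ) (m : ℕ) : Finset ℕ :=
  A.filter fun a => m ≤ a ∧ ∀ m' ∈ M, m' ≤ a → m' ≤ m

theorem mem_markBlock {A M : Finset ℕ} {m a : ℕ} :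
    a ∈ markBlock A M m ↔ a ∈ A ∧ m ≤ a ∧ ∀ m' ∈ M, m' ≤ a → m' ≤ m := by
  simp [markBlock]

/-- The unions of successive members of `F` whose minima form a member of `G`. -/
def Conv (F G : Set (Finset ℕ)) : Set (Finset ℕ) :=
  {A | ∃ M ∈ G, M ⊆ A ∧ (∀ a ∈ A, ∃ m ∈ M, m ≤ a) ∧ ∀ m ∈ M, markBlock A M m ∈ F}

theorem conv_mono {F G G' : Set (Finset ℕ)} (h : G ⊆ G') : Conv F G ⊆ Conv F G' :=
  fun _ ⟨M, hM, h'⟩ => ⟨M, h hM, h'⟩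

theorem conv_base {F : Set (Finset ℕ)} (hF : IsSchreierLike F) :
    Conv F {A | A = ∅ ∨ ∃ n, 1 ≤ n ∧ A = {n}} = F := by
  ext A
  constructor
  · rintro ⟨M, rfl | ⟨n, -, rfl⟩, hMA, hcov, hblk⟩
    · have : A = ∅ := Finset.eq_empty_of_forall_notMem fun a ha => by
        obtain ⟨m, hm, -⟩ := hcov a ha
        simp at hm
      exact this ▸ hF.empty_mem
    · have h := hblk n (by simp)
      convert h using 1
      ext a
      rw [mem_markBlock]
      refine ⟨fun ha => ⟨ha, ?_, by simp⟩, fun h => h.1⟩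
      obtain ⟨m, hm, hma⟩ := hcov a ha
      simpa [Finset.mem_singleton.1 hm] using hma
  · intro hA
    by_cases hne : A.Nonempty
    · refine ⟨{minElt A}, Or.inr ⟨minElt A, hF.pos A hA _ (minElt_mem hne), rfl⟩,
        by simpa using minElt_mem hne, fun a ha => ⟨_, by simp, minElt_le ha⟩, fun m _ => ?_⟩
      exact hF.down A hA _ fun a ha => (mem_markBlock.1 ha).1
    · rw [Finset.not_nonempty_iff_eq_empty.1 hne]
      exact ⟨∅, Or.inl rfl, by simp⟩

/-- Decompositions of the marks correspond to decompositions of the whole set. The bound `n ≤ min`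
transfers both ways, because the marks lie in `A` and every point of `A` has a mark below it. -/
theorem conv_succ {F G : Set (Finset ℕ)} :
    Conv F {A | ∃ (n : ℕ) (E : Fin n → Finset ℕ),
      (∀ a ∈ A, n ≤ a) ∧ IsBlockDecomp A n E ∧ ∀ j, E j ∈ G} =
    {A | ∃ (n : ℕ) (E : Fin n → Finset ℕ),
      (∀ a ∈ A, n ≤ a) ∧ IsBlockDecomp A n E ∧ ∀ j, E j ∈ Conv F G} := by
  classical
  ext A
  constructor
  · rintro ⟨M, ⟨n, E, hn, ⟨hE1, hE2⟩, hEG⟩, hMA, hcov, hblk⟩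
    have hEM : ∀ j, E j ⊆ M := fun j x hx => by
      rw [hE2]; exact Finset.mem_biUnion.2 ⟨j, by simp, hx⟩
    have hlast : ∀ a ∈ A, ∃ j, ∃ m ∈ E j, a ∈ markBlock A M m := by
      intro a ha
      obtain ⟨m, hm, hma⟩ := hcov a ha
      have hne : (upTo M a).Nonempty := ⟨m, mem_upTo.2 ⟨hm, hma⟩⟩
      have hx := Finset.max'_mem _ hne
      obtain ⟨hxM, hxa⟩ := mem_upTo.1 hx
      obtain ⟨j, -, hj⟩ := Finset.mem_biUnion.1 (hE2.subset hxM)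
      exact ⟨j, _, hj, mem_markBlock.2 ⟨ha, hxa, fun m' hm' hm'a =>
        Finset.le_max' _ _ (mem_upTo.2 ⟨hm', hm'a⟩)⟩⟩
    refine ⟨n, fun j => (E j).biUnion fun m => markBlock A M m, ?_, ⟨?_, ?_⟩, ?_⟩
    · intro a ha
      obtain ⟨m, hm, hma⟩ := hcov a ha
      exact (hn m hm).trans hma
    · intro i j hij a ha b hb
      obtain ⟨m, hm, ha⟩ := Finset.mem_biUnion.1 ha
      obtain ⟨m', hm', hb⟩ := Finset.mem_biUnion.1 hb
      have hlt := hE1 i j hij m hm m' hm'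
      by_contra hba
      have h1 := (mem_markBlock.1 hb).2.1
      have := (mem_markBlock.1 ha).2.2 m' (hEM j hm') (by omega)
      omega
    · ext a
      simp only [Finset.mem_biUnion, Finset.mem_univ, true_and]
      constructor
      · exact hlast a
      · rintro ⟨j, m, -, h⟩
        exact (mem_markBlock.1 h).1
    · intro j
      refine ⟨E j, hEG j, fun m hm => ?_, fun a ha => ?_, fun m hm => ?_⟩
      · exact Finset.mem_biUnion.2 ⟨m, hm, mem_markBlock.2 ⟨hMA (hEM j hm), le_rfl, by simp⟩⟩
      · obtain ⟨m, hm, h⟩ := Finset.mem_biUnion.1 ha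
        exact ⟨m, hm, (mem_markBlock.1 h).2.1⟩
      · have : markBlock ((E j).biUnion fun m => markBlock A M m) (E j) m = markBlock A M m := by
          ext a
          rw [mem_markBlock]
          constructor
          · rintro ⟨ha, hma, hmax⟩
            obtain ⟨m', hm', h⟩ := Finset.mem_biUnion.1 ha
            have h' := mem_markBlock.1 h
            have h1 := hmax m' hm' h'.2.1
            have h2 := h'.2.2 m (hEM j hm) hma
            have : m = m' := le_antisymm h2 h1
            exact this ▸ h
          · intro h
            have h' := mem_markBlock.1 h
            exact ⟨Finset.mem_biUnion.2 ⟨m, hm, h⟩, h'.2.1,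
              fun m' hm' hma => h'.2.2 m' (hEM j hm') hma⟩
        rw [this]
        exact hblk m (hEM j hm)
  · rintro ⟨n, E, hn, ⟨hE1, hE2⟩, hE⟩
    choose M hMG hME hcov hblk using hE
    have hEA : ∀ j, E j ⊆ A := fun j x hx => by
      rw [hE2]; exact Finset.mem_biUnion.2 ⟨j, by simp, hx⟩
    have hsame : ∀ i j, ∀ a ∈ E i, ∀ m ∈ M j, m ≤ a → j ≤ i := by
      intro i j a ha m hm hma
      by_contra hlt
      have := hE1 i j (by omega) a ha m (hME j hm)
      omega
    refine ⟨Finset.univ.biUnion M, ⟨n, M, ?_, ⟨?_, rfl⟩, hMG⟩, ?_, ?_, ?_⟩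
    · intro a ha
      obtain ⟨j, -, hj⟩ := Finset.mem_biUnion.1 ha
      exact hn a (hEA j (hME j hj))
    · intro i j hij a ha b hb
      exact hE1 i j hij a (hME i ha) b (hME j hb)
    · intro a ha
      obtain ⟨j, -, hj⟩ := Finset.mem_biUnion.1 ha
      exact hEA j (hME j hj)
    · intro a ha
      rw [hE2] at ha
      obtain ⟨j, -, hj⟩ := Finset.mem_biUnion.1 ha
      obtain ⟨m, hm, hma⟩ := hcov j a hj
      exact ⟨m, Finset.mem_biUnion.2 ⟨j, by simp, hm⟩, hma⟩
    · intro m hm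
      obtain ⟨j, -, hj⟩ := Finset.mem_biUnion.1 hm
      have : markBlock A (Finset.univ.biUnion M) m = markBlock (E j) (M j) m := by
        ext a
        rw [mem_markBlock, mem_markBlock]
        constructor
        · rintro ⟨ha, hma, hmax⟩
          refine ⟨?_, hma, fun m' hm' => hmax m' (Finset.mem_biUnion.2 ⟨j, by simp, hm'⟩)⟩
          rw [hE2] at ha
          obtain ⟨i, -, hi⟩ := Finset.mem_biUnion.1 ha
          have hji := hsame i j a hi m hj hma
          rcases hji.eq_or_lt with rfl | hlt
          · exact hi
          · obtain ⟨m', hm', hma'⟩ := hcov i a hi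
            have h1 := hmax m' (Finset.mem_biUnion.2 ⟨i, by simp, hm'⟩) hma'
            have h2 := hE1 j i hlt m (hME j hj) m' (hME i hm')
            omega
        · rintro ⟨ha, hma, hmax⟩
          refine ⟨hEA j ha, hma, fun m' hm' hma' => ?_⟩
          obtain ⟨i, -, hi⟩ := Finset.mem_biUnion.1 hm'
          rcases (hsame j i a ha m' hi hma').eq_or_lt with rfl | hlt
          · exact hmax m' hi hma'
          · exact (hE1 i j hlt m' (hME i hi) m (hME j hj)).le
      rw [this]
      exact hblk j m hj

/-! ### Structure of the Schreier families -/

/-- This splits off the last term of the Cantor normal form, by induction after removal of the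
leading terms. -/
theorem exists_eq_add_omega0_opow (γ : Ordinal.{0}) (h : γ ≠ 0) :
    ∃ δ ξ : Ordinal.{0}, ω ^ ξ ∣ δ ∧ γ = δ + ω ^ ξ := by
  induction γ using WellFoundedLT.induction with
  | ind γ ih =>
    set e := Ordinal.log ω γ
    have hpos : (ω : Ordinal.{0}) ^ e ≠ 0 := (Ordinal.opow_pos e omega0_pos).ne'
    have hdm := Ordinal.div_add_mod γ (ω ^ e)
    by_cases hr : γ % ω ^ e = 0
    · rw [hr, add_zero] at hdm
      have hk : γ / ω ^ e < ω := Ordinal.div_opow_log_lt γ one_lt_omega0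
      obtain ⟨k, hk⟩ := lt_omega0.1 hk
      obtain _ | k := k
      · rw [hk] at hdm
        simp at hdm
        exact absurd hdm.symm h
      · refine ⟨ω ^ e * k, e, dvd_mul_right _ _, ?_⟩
        rw [← hdm, hk, Nat.cast_succ, mul_add, mul_one]
    · have hlt : γ % ω ^ e < ω ^ e := Ordinal.mod_lt γ hpos
      have hle : ω ^ e ≤ γ := Ordinal.opow_log_le_self ω h
      obtain ⟨δ, ξ, hd, heq⟩ := ih _ (hlt.trans_le hle) hr
      have hξ : ω ^ ξ < ω ^ e := lt_of_le_of_lt (by rw [heq]; exact le_add_self) hlt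
      have hξe : ξ ≤ e := ((Ordinal.opow_lt_opow_iff_right one_lt_omega0).1 hξ).le
      refine ⟨ω ^ e * (γ / ω ^ e) + δ, ξ, ?_, ?_⟩
      · exact dvd_add ((Ordinal.opow_dvd_opow ω hξe).mul_right _) hd
      · rw [add_assoc, ← heq, hdm]

theorem exists_eq_add_omega0_opow_of_isSuccLimit {γ : Ordinal.{0}} (h : IsSuccLimit γ) :
    ∃ δ ξ : Ordinal.{0}, 1 ≤ ξ ∧ ω ^ ξ ∣ δ ∧ γ = δ + ω ^ ξ := by
  obtain ⟨δ, ξ, hd, heq⟩ := exists_eq_add_omega0_opow γ h.ne_bot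
  refine ⟨δ, ξ, ?_, hd, heq⟩
  rw [Order.one_le_iff_ne_zero]
  rintro rfl
  rw [opow_zero] at heq
  rw [heq] at h
  simp at h

/-! ### Heredity, addition of indices, monotonicity and rank of the Schreier families. -/

section Families

theorem IsApproxSystem.schreier_limit {lam : Ordinal.{0} → ℕ → Ordinal.{0}}
    (hlam : IsApproxSystem lam) {γ : Ordinal.{0}} (hγ : IsSuccLimit γ) (hγ1 : γ < ω_ 1) :
    schreier lam γ = {A | ∃ k, 1 ≤ k ∧ (∀ a ∈ A, k ≤ a) ∧ A ∈ schreier lam (lam γ k)} :=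
  _root_.schreier_limit lam γ hγ (hlam.lt γ hγ hγ1)

theorem schreier_add_one_eq_blocks (lam : Ordinal.{0} → ℕ → Ordinal.{0}) (γ : Ordinal.{0}) :
    schreier lam (γ + 1) = {A | ∃ n : ℕ, (∀ a ∈ A, n ≤ a) ∧ A ∈ Blocks (schreier lam γ) n} := by
  rw [schreier_add_one]
  ext A
  constructor
  · rintro ⟨n, E, hn, hE⟩
    exact ⟨n, hn, mem_blocks_iff.2 ⟨E, hE⟩⟩
  · rintro ⟨n, hn, hA⟩
    obtain ⟨E, hE⟩ := mem_blocks_iff.1 hA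
    exact ⟨n, E, hn, hE⟩

theorem isSchreierLike_schreier {lam : Ordinal.{0} → ℕ → Ordinal.{0}}
    (hlam : IsApproxSystem lam) (α : Ordinal.{0}) (hα : α < ω_ 1) :
    IsSchreierLike (schreier lam α) := by
  induction α using Ordinal.limitRecOn with
  | zero =>
    rw [schreier_zero]
    refine ⟨fun n hn => Or.inr ⟨n, hn, rfl⟩, ?_, ?_, ?_⟩
    · rintro A (rfl | ⟨n, hn, rfl⟩) B hB
      · exact Or.inl (Finset.subset_empty.1 hB)
      · rcases Finset.subset_singleton_iff.1 hB with h | h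
        · exact Or.inl h
        · exact Or.inr ⟨n, hn, h⟩
    · rintro A (rfl | ⟨n, hn, rfl⟩) a ha
      · simp at ha
      · simpa [Finset.mem_singleton.1 ha] using hn
    · rintro E ⟨e, he⟩ k l hk hl (h | ⟨n, hn, h⟩)
      · simp at h
      · have h1 : e = n := by simpa [h] using (Finset.mem_insert_of_mem he : e ∈ insert l E)
        have h2 : l = n := by simpa [h] using Finset.mem_insert_self l E
        have := hl e he
        omega
  | add_one γ ih =>
    have hF := ih (lt_of_le_of_lt le_self_add hα)
    rw [schreier_add_one_eq_blocks]
    refine ⟨fun n hn => ⟨1, by simpa using hn, mem_blocks_one (hF.singleton n hn)⟩, ?_, ?_, ?_⟩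
    · rintro A ⟨n, hn, hA⟩ B hB
      exact ⟨n, fun a ha => hn a (hB ha), IsSchreierLike.blocks_down hF.down n A hA B hB⟩
    · rintro A ⟨n, hn, hA⟩
      exact IsSchreierLike.blocks_pos hF.pos n A hA
    · rintro E hne k l hk hl ⟨n, hn, hA⟩
      refine ⟨n, fun a ha => ?_, hF.blocks_insert n E hne k l hk hl hA⟩
      obtain ⟨e, he⟩ := hne
      have h1 := hn e (Finset.mem_insert_of_mem he)
      rcases Finset.mem_insert.1 ha with rfl | h
      · exact h1.trans (hk e he).le
      · exact hn a (Finset.mem_insert_of_mem h)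
  | limit γ hγ ih =>
    have hF : ∀ k, 1 ≤ k → IsSchreierLike (schreier lam (lam γ k)) := fun k hk =>
      ih _ (hlam.lt γ hγ hα k hk) ((hlam.lt γ hγ hα k hk).trans hα)
    rw [hlam.schreier_limit hγ hα]
    refine ⟨fun n hn => ⟨1, le_rfl, by simpa using hn, (hF 1 le_rfl).singleton n hn⟩, ?_, ?_, ?_⟩
    · rintro A ⟨n, h1, hn, hA⟩ B hB
      exact ⟨n, h1, fun a ha => hn a (hB ha), (hF n h1).down A hA B hB⟩
    · rintro A ⟨n, h1, hn, hA⟩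
      exact (hF n h1).pos A hA
    · rintro E hne k l hk hl ⟨n, hn1, hn, hA⟩
      refine ⟨n, hn1, fun a ha => ?_, (hF n hn1).insert_of_insert E hne k l hk hl hA⟩
      obtain ⟨e, he⟩ := hne
      have h1 := hn e (Finset.mem_insert_of_mem he)
      rcases Finset.mem_insert.1 ha with rfl | h
      · exact h1.trans (hk e he).le
      · exact hn a (Finset.mem_insert_of_mem h)

/-- The induction rests on `Conv` commuting with the successor and limit steps. Because `β < ω ^ ξ`
and `ω ^ ξ ∣ δ`, the normal form of `δ + β` is a concatenation. -/
theorem schreier_add_eq_conv {lam : Ordinal.{0} → ℕ → Ordinal.{0}}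
    (hlam : IsApproxSystem lam) {δ ξ : Ordinal.{0}} (hδ0 : δ ≠ 0) (hδ : ω ^ ξ ∣ δ)
    (hδ1 : δ + ω ^ ξ < ω_ 1) (β : Ordinal.{0}) (hβ : β < ω ^ ξ) :
    schreier lam (δ + β) = Conv (schreier lam δ) (schreier lam β) := by
  have hδlt : δ < ω_ 1 := lt_of_le_of_lt le_self_add hδ1
  induction β using Ordinal.limitRecOn with
  | zero =>
    rw [add_zero, schreier_zero, conv_base (isSchreierLike_schreier hlam δ hδlt)]
  | add_one β ih =>
    rw [← add_assoc, schreier_add_one, schreier_add_one, conv_succ,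
      ih (lt_of_le_of_lt le_self_add hβ)]
  | limit β hlim ih =>
    have hβ1 : β < ω_ 1 := (hβ.trans_le le_add_self).trans hδ1
    have hδβ1 : δ + β < ω_ 1 := ((add_lt_add_iff_left δ).2 hβ).trans hδ1
    obtain ⟨δ', η, hη, hd, heq⟩ := exists_eq_add_omega0_opow_of_isSuccLimit hlim
    have hηξ : η ≤ ξ := by
      refine ((Ordinal.opow_lt_opow_iff_right one_lt_omega0).1 (lt_of_le_of_lt ?_ hβ)).le
      rw [heq]; exact le_add_self
    -- Both `β` and `δ + β` end in the term `ω ^ η`, so the normal form condition computes both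
    -- sequences from `lam (ω ^ η)`. For `δ' = 0`, `β` is this power itself.
    have hlamβ : ∀ n, 1 ≤ n → lam (δ + β) n = δ + lam β n := by
      intro n hn
      have h1 : lam (δ + β) n = δ + δ' + lam (ω ^ η) n := by
        rw [heq, ← add_assoc] at hδβ1 ⊢
        refine hlam.cantor _ η hη ?_ (dvd_add ((Ordinal.opow_dvd_opow ω hηξ).trans hδ) hd)
          hδβ1 n hn
        exact (lt_of_lt_of_le (pos_iff_ne_zero.2 hδ0) le_self_add).ne'
      by_cases h0 : δ' = 0
      · subst h0
        rw [h1, heq]; simp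
      · rw [h1, add_assoc, ← hlam.cantor δ' η hη h0 hd (heq ▸ hβ1) n hn, ← heq]
    have hlim' : IsSuccLimit (δ + β) := Ordinal.isSuccLimit_add δ hlim
    rw [hlam.schreier_limit hlim' hδβ1, hlam.schreier_limit hlim hβ1]
    ext A
    constructor
    · rintro ⟨k, hk, hkA, hA⟩
      rw [hlamβ k hk, ih _ (hlam.lt β hlim hβ1 k hk) ((hlam.lt β hlim hβ1 k hk).trans hβ)] at hA
      obtain ⟨M, hM, hMA, h⟩ := hA
      exact ⟨M, ⟨k, hk, fun a ha => hkA a (hMA ha), hM⟩, hMA, h⟩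
    · rintro ⟨M, ⟨k, hk, hkM, hM⟩, hMA, hcov, h⟩
      refine ⟨k, hk, fun a ha => ?_, ?_⟩
      · obtain ⟨m, hm, hma⟩ := hcov a ha
        exact (hkM m hm).trans hma
      · rw [hlamβ k hk, ih _ (hlam.lt β hlim hβ1 k hk) ((hlam.lt β hlim hβ1 k hk).trans hβ)]
        exact ⟨M, hM, hMA, hcov, h⟩

/-- For powers of `ω` this is assumed; the general case reduces to it, since `Conv` is monotone in
the family of marks. -/
theorem schreier_lam_mono {lam : Ordinal.{0} → ℕ → Ordinal.{0}}
    (hlam : IsApproxSystem lam) {γ : Ordinal.{0}} (hγ : IsSuccLimit γ) (hγ1 : γ < ω_ 1) {m n : ℕ}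
    (hm : 1 ≤ m) (hmn : m ≤ n) : schreier lam (lam γ m) ⊆ schreier lam (lam γ n) := by
  induction n, hmn using Nat.le_induction with
  | base => exact subset_rfl
  | succ n hmn ih =>
    refine ih.trans ?_
    have hn : 1 ≤ n := hm.trans hmn
    obtain ⟨δ, ξ, hξ, hd, heq⟩ := exists_eq_add_omega0_opow_of_isSuccLimit hγ
    have hξ1 : ω ^ ξ < ω_ 1 := lt_of_le_of_lt (heq ▸ le_add_self) hγ1
    by_cases h0 : δ = 0
    · subst h0
      rw [zero_add] at heq
      rw [heq]
      exact hlam.subset ξ hξ hξ1 n hn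
    · have hlim : IsSuccLimit ((ω : Ordinal.{0}) ^ ξ) :=
        Ordinal.isSuccLimit_opow_left isSuccLimit_omega0 (Order.one_le_iff_ne_zero.1 hξ)
      subst heq
      rw [hlam.cantor δ ξ hξ h0 hd hγ1 n hn, hlam.cantor δ ξ hξ h0 hd hγ1 (n + 1) (by omega),
        schreier_add_eq_conv hlam h0 hd hγ1 _ (hlam.lt _ hlim hξ1 _ hn),
        schreier_add_eq_conv hlam h0 hd hγ1 _ (hlam.lt _ hlim hξ1 _ (by omega))]
      exact conv_mono (hlam.subset ξ hξ hξ1 n hn)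

theorem mem_schreier_limit_iff {lam : Ordinal.{0} → ℕ → Ordinal.{0}}
    (hlam : IsApproxSystem lam) {γ : Ordinal.{0}} (hγ : IsSuccLimit γ) (hγ1 : γ < ω_ 1)
    {A : Finset ℕ} (hA : A.Nonempty) :
    A ∈ schreier lam γ ↔ 1 ≤ minElt A ∧ A ∈ schreier lam (lam γ (minElt A)) := by
  rw [hlam.schreier_limit hγ hγ1]
  constructor
  · rintro ⟨k, hk, hkA, h⟩
    have := hkA _ (minElt_mem hA)
    exact ⟨hk.trans this, schreier_lam_mono hlam hγ hγ1 hk this h⟩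
  · rintro ⟨h1, h⟩
    exact ⟨minElt A, h1, fun a ha => minElt_le ha, h⟩

theorem mem_schreier_add_one_iff {lam : Ordinal.{0} → ℕ → Ordinal.{0}}
    (hlam : IsApproxSystem lam) {γ : Ordinal.{0}} (hγ : γ < ω_ 1)
    {A : Finset ℕ} (hA : A.Nonempty) :
    A ∈ schreier lam (γ + 1) ↔ A ∈ Blocks (schreier lam γ) (minElt A) := by
  rw [schreier_add_one_eq_blocks]
  constructor
  · rintro ⟨k, hkA, h⟩
    exact blocks_mono (isSchreierLike_schreier hlam γ hγ).empty_mem (hkA _ (minElt_mem hA)) h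
  · exact fun h => ⟨minElt A, fun a ha => minElt_le ha, h⟩

theorem hasRank_schreier {lam : Ordinal.{0} → ℕ → Ordinal.{0}}
    (hlam : IsApproxSystem lam) (α : Ordinal.{0}) (hα : α < ω_ 1) :
    HasRank (schreier lam α) (ω ^ α) := by
  induction α using Ordinal.limitRecOn with
  | zero =>
    rw [schreier_zero, opow_zero]
    refine ⟨fun A => if A = ∅ then 1 else 0, by simp, ?_⟩
    rintro A (rfl | ⟨n, -, rfl⟩) B hB hAB hne
    · have : B ≠ ∅ := hne.symm
      simp [this]
    · rcases hB with rfl | ⟨m, -, rfl⟩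
      · simpa using hAB.1
      · have := hAB.1
        simp at this
        exact absurd (by rw [this]) hne
  | add_one γ ih =>
    have hγ : γ < ω_ 1 := lt_of_le_of_lt le_self_add hα
    have hF := isSchreierLike_schreier hlam γ hγ
    refine HasRank.of_fibers (fun n _ => (ih hγ).blocks hF n) (fun n _ => ?_)
      (fun n _ => empty_mem_blocks hF.empty_mem n) fun A hA hne => ⟨?_, ?_⟩
    · rw [← Order.succ_eq_add_one, opow_succ]
      gcongr
      exact (natCast_lt_omega0 n).le
    · exact (isSchreierLike_schreier hlam _ hα).pos A hA _ (minElt_mem hne)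
    · exact (mem_schreier_add_one_iff hlam hγ hne).1 hA
  | limit γ hγ ih =>
    refine HasRank.of_fibers (G := fun n => schreier lam (lam γ n))
      (p := fun n => ω ^ lam γ n) (fun n hn => ?_) (fun n hn => ?_) (fun n hn => ?_)
      fun A hA hne => (mem_schreier_limit_iff hlam hγ hα hne).1 hA
    · exact ih _ (hlam.lt γ hγ hα n hn) ((hlam.lt γ hγ hα n hn).trans hα)
    · exact Ordinal.opow_le_opow_right omega0_pos (hlam.lt γ hγ hα n hn).le
    · exact (isSchreierLike_schreier hlam _ ((hlam.lt γ hγ hα n hn).trans hα)).empty_mem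

end Families

/-! ### Repeated averages -/

open Classical in
theorem maxAverage_zero (lam : Ordinal.{0} → ℕ → Ordinal.{0}) (A : Finset ℕ) (a : ℕ) :
    maxAverage lam 0 A a = if A = {a} then 1 else 0 := by
  simp [maxAverage]

open Classical in
theorem maxAverage_add_one (lam : Ordinal.{0} → ℕ → Ordinal.{0}) (γ : Ordinal.{0})
    (A : Finset ℕ) (a : ℕ) :
    maxAverage lam (γ + 1) A a = if h : ∃ p, IsMaxDecomp (schreier lam γ) A p then
        (1 / (h.choose.1 : ℝ)) * ∑ j, maxAverage lam γ (h.choose.2 j) a else 0 := by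
  simp [maxAverage]

theorem maxAverage_limit (lam : Ordinal.{0} → ℕ → Ordinal.{0}) {γ : Ordinal.{0}}
    (hγ : IsSuccLimit γ) (A : Finset ℕ) (a : ℕ) (h : lam γ (minElt A) < γ) :
    maxAverage lam γ A a = maxAverage lam (lam γ (minElt A)) A a := by
  rw [maxAverage, Ordinal.limitRecOn_limit _ _ _ _ hγ, dif_pos h]
  rfl

theorem maxAverage_limit_of_not_lt (lam : Ordinal.{0} → ℕ → Ordinal.{0}) {γ : Ordinal.{0}}
    (hγ : IsSuccLimit γ) (A : Finset ℕ) (a : ℕ) (h : ¬ lam γ (minElt A) < γ) :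
    maxAverage lam γ A a = 0 := by
  rw [maxAverage, Ordinal.limitRecOn_limit _ _ _ _ hγ, dif_neg h]

theorem maxAverage_nonneg (lam : Ordinal.{0} → ℕ → Ordinal.{0}) (α : Ordinal.{0})
    (A : Finset ℕ) (a : ℕ) : 0 ≤ maxAverage lam α A a := by
  induction α using Ordinal.limitRecOn generalizing A a with
  | zero => rw [maxAverage_zero]; split_ifs <;> simp
  | add_one γ ih =>
    rw [maxAverage_add_one]
    split_ifs
    · exact mul_nonneg (by positivity) (Finset.sum_nonneg fun j _ => ih _ _)
    · exact le_rfl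
  | limit γ hγ ih =>
    by_cases h : lam γ (minElt A) < γ
    · rw [maxAverage_limit lam hγ A a h]; exact ih _ h _ _
    · rw [maxAverage_limit_of_not_lt lam hγ A a h]

theorem maxAverage_eq_zero (lam : Ordinal.{0} → ℕ → Ordinal.{0}) (α : Ordinal.{0})
    (A : Finset ℕ) (a : ℕ) (ha : a ∉ A) : maxAverage lam α A a = 0 := by
  induction α using Ordinal.limitRecOn generalizing A a with
  | zero =>
    rw [maxAverage_zero, if_neg]
    rintro rfl
    simp at ha
  | add_one γ ih =>
    rw [maxAverage_add_one]
    split_ifs with h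
    · rw [Finset.sum_eq_zero, mul_zero]
      intro j _
      refine ih _ _ fun hj => ha ?_
      rw [h.choose_spec.2.2.1.2]
      exact Finset.mem_biUnion.2 ⟨j, by simp, hj⟩
    · rfl
  | limit γ hγ ih =>
    by_cases h : lam γ (minElt A) < γ
    · rw [maxAverage_limit lam hγ A a h]; exact ih _ h _ _ ha
    · rw [maxAverage_limit_of_not_lt lam hγ A a h]

/-- Successive maximal members of a family are determined by the part of their union seen so far:
a function of maximal members and points that only looks at initial parts has equal block sums. -/
theorem sum_blocks_eq_of_agree {F : Set (Finset ℕ)} {z : Finset ℕ → ℕ → ℝ}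
    (hz0 : ∀ A a, a ∉ A → z A a = 0)
    (hz : ∀ M ∈ maxMembers F, ∀ N ∈ maxMembers F, ∀ a ∈ M, (∀ b ≤ a, b ∈ M ↔ b ∈ N) →
      z M a = z N a)
    (n : ℕ) (E E' : Fin n → Finset ℕ) (M N : Finset ℕ) (hE : IsBlockDecomp M n E)
    (hE' : IsBlockDecomp N n E') (hEF : ∀ j, E j ∈ maxMembers F) (hEF' : ∀ j, E' j ∈ maxMembers F)
    (a : ℕ) (ha : a ∈ M) (h : ∀ b ≤ a, b ∈ M ↔ b ∈ N) :
    ∑ j, z (E j) a = ∑ j, z (E' j) a := by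
  induction n generalizing M N with
  | zero => simp
  | succ n ih =>
    have hinit : ∀ (D : Finset ℕ) (G : Fin (n + 1) → Finset ℕ), IsBlockDecomp D (n + 1) G →
        IsInitSeg (G 0) D := by
      rintro D G ⟨h1, h2⟩
      refine ⟨fun x hx => by rw [h2]; exact Finset.mem_biUnion.2 ⟨0, by simp, hx⟩,
        fun x hx y hy hyx => ?_⟩
      rw [h2] at hy
      obtain ⟨j, -, hj⟩ := Finset.mem_biUnion.1 hy
      rcases (Fin.zero_le j).eq_or_lt with rfl | hlt
      · exact hj
      · have := h1 0 j hlt x hx y hj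
        omega
    have htail : ∀ (D : Finset ℕ) (G : Fin (n + 1) → Finset ℕ), IsBlockDecomp D (n + 1) G →
        IsBlockDecomp (D \ G 0) n (fun j => G j.succ) := by
      rintro D G ⟨h1, h2⟩
      refine ⟨fun i j hij => h1 _ _ (by simpa using hij), ?_⟩
      ext x
      rw [h2]
      simp only [Finset.mem_sdiff, Finset.mem_biUnion, Finset.mem_univ, true_and,
        Fin.exists_fin_succ]
      constructor
      · rintro ⟨h | h, h'⟩
        · exact absurd h h'
        · exact h
      · rintro ⟨i, hi⟩
        exact ⟨Or.inr ⟨i, hi⟩, fun h0 => lt_irrefl _ (h1 0 i.succ (Fin.succ_pos i) x h0 x hi)⟩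
    have hsum : ∀ (D : Finset ℕ) (G : Fin (n + 1) → Finset ℕ), IsBlockDecomp D (n + 1) G →
        a ∈ G 0 → ∑ j : Fin n, z (G j.succ) a = 0 := by
      rintro D G ⟨h1, h2⟩ h0
      refine Finset.sum_eq_zero fun j _ => hz0 _ _ fun hj => ?_
      exact lt_irrefl _ (h1 0 j.succ (Fin.succ_pos j) a h0 a hj)
    have hMi := hinit M E hE
    have hNi := hinit N E' hE'
    have haN : a ∈ N := (h a le_rfl).1 ha
    rw [Fin.sum_univ_succ, Fin.sum_univ_succ]
    by_cases hboth : a ∈ E 0 ∧ a ∈ E' 0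
    · rw [hsum M E hE hboth.1, hsum N E' hE' hboth.2]
      congr 1
      refine hz _ (hEF 0) _ (hEF' 0) a hboth.1 fun b hb => ?_
      exact ⟨fun hb0 => hNi.2 a hboth.2 b ((h b hb).1 (hMi.1 hb0)) hb,
        fun hb0 => hMi.2 a hboth.1 b ((h b hb).2 (hNi.1 hb0)) hb⟩
    -- A block that does not contain `a` ends before `a`, hence is an initial segment of the other
    -- union too; it is then comparable with the first block there, and maximality forces equality.
    · have hcomp : ∀ (M' N' P Q : Finset ℕ), IsInitSeg P M' → IsInitSeg Q N' → a ∈ M' →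
          (∀ b ≤ a, b ∈ M' ↔ b ∈ N') → P ∈ maxMembers F → Q ∈ maxMembers F → a ∉ P →
          P = Q := by
        intro M' N' P Q hP hQ haM hag hPF hQF haP
        have hlt : ∀ p ∈ P, p ≤ a := fun p hp => by
          by_contra hpa
          exact haP (hP.2 p hp a haM (by omega))
        have hPN : IsInitSeg P N' := ⟨fun p hp => (hag p (hlt p hp)).1 (hP.1 hp),
          fun p hp q hq hqp => hP.2 p hp q ((hag q (hqp.trans (hlt p hp))).2 hq) hqp⟩
        rcases hPN.total hQ with hc | hc
        · exact (hPF.2 Q hQF.1 hc).symm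
        · exact hQF.2 P hPF.1 hc
      have heq : E 0 = E' 0 := by
        by_cases h1 : a ∈ E 0
        · exact (hcomp N M _ _ hNi hMi haN (fun b hb => (h b hb).symm) (hEF' 0) (hEF 0)
            fun h2 => hboth ⟨h1, h2⟩).symm
        · exact hcomp M N _ _ hMi hNi ha h (hEF 0) (hEF' 0) h1
      have hna : a ∉ E 0 := fun h1 => hboth ⟨h1, heq ▸ h1⟩
      rw [heq]
      congr 1
      refine ih _ _ _ _ (htail M E hE) (htail N E' hE') (fun j => hEF _) (fun j => hEF' _)
        (Finset.mem_sdiff.2 ⟨ha, hna⟩) fun b hb => ?_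
      rw [Finset.mem_sdiff, Finset.mem_sdiff, h b hb, heq]

/-! ### Coherence of the repeated averages. -/

section Families

variable {lam : Ordinal.{0} → ℕ → Ordinal.{0}} {α : Ordinal.{0}}

theorem IsSchreierLike.nonempty_of_mem_maxMembers {F : Set (Finset ℕ)} (hF : IsSchreierLike F)
    {A : Finset ℕ} (hA : A ∈ maxMembers F) : A.Nonempty := by
  rw [Finset.nonempty_iff_ne_empty]
  rintro rfl
  have := hA.2 {1} (hF.singleton 1 le_rfl) (isInitSeg_empty _)
  simp at this

theorem exists_isMaxDecomp (hlam : IsApproxSystem lam) {γ : Ordinal.{0}} (hγ : γ + 1 < ω_ 1)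
    {A : Finset ℕ} (hA : A ∈ maxMembers (schreier lam (γ + 1))) :
    ∃ p, IsMaxDecomp (schreier lam γ) A p := by
  have hγ1 : γ < ω_ 1 := lt_of_le_of_lt le_self_add hγ
  have hne := (isSchreierLike_schreier hlam _ hγ).nonempty_of_mem_maxMembers hA
  have hF := isSchreierLike_schreier hlam _ hγ1
  have h := mem_blocks_maxMembers hF (minElt A) A
    ((mem_schreier_add_one_iff hlam hγ1 hne).1 hA.1) fun k _ hkA h => by
      have hins := isInitSeg_insert hkA
      rw [hins.minElt_eq hne, ← mem_schreier_add_one_iff hlam hγ1 (Finset.insert_nonempty _ _)] at h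
      have := hA.2 _ h hins
      exact lt_irrefl k (hkA k (this ▸ Finset.mem_insert_self _ _))
  obtain ⟨E, hE, hEF⟩ := mem_blocks_iff.1 h
  exact ⟨⟨minElt A, E⟩, hne, rfl, hE, hEF⟩

theorem mem_maxMembers_of_limit (hlam : IsApproxSystem lam) {γ : Ordinal.{0}}
    (hγ : IsSuccLimit γ) (hγ1 : γ < ω_ 1) {A : Finset ℕ} (hA : A ∈ maxMembers (schreier lam γ)) :
    1 ≤ minElt A ∧ A ∈ maxMembers (schreier lam (lam γ (minElt A))) := by
  have hne := (isSchreierLike_schreier hlam _ hγ1).nonempty_of_mem_maxMembers hA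
  obtain ⟨h1, h2⟩ := (mem_schreier_limit_iff hlam hγ hγ1 hne).1 hA.1
  refine ⟨h1, h2, fun B hB hAB => hA.2 B ?_ hAB⟩
  rw [mem_schreier_limit_iff hlam hγ hγ1 (hne.mono hAB.1), ← hAB.minElt_eq hne]
  exact ⟨h1, hB⟩

/-- The weight at `a` depends only on the part of the maximal set up to `a`. This makes the
restriction to `A ∈ S_α` independent of the maximal extension. -/
theorem maxAverage_eq_of_agree (hlam : IsApproxSystem lam) (hα : α < ω_ 1) {M N : Finset ℕ}
    (hM : M ∈ maxMembers (schreier lam α)) (hN : N ∈ maxMembers (schreier lam α)) {a : ℕ}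
    (ha : a ∈ M) (h : ∀ b ≤ a, b ∈ M ↔ b ∈ N) :
    maxAverage lam α M a = maxAverage lam α N a := by
  induction α using Ordinal.limitRecOn generalizing M N a with
  | zero =>
    have key : ∀ D ∈ maxMembers (schreier lam 0), a ∈ D → D = {a} := by
      intro D hD haD
      have := hD.1
      rw [schreier_zero] at this
      rcases this with rfl | ⟨n, -, rfl⟩
      · simp at haD
      · rw [Finset.mem_singleton.1 haD]
    rw [key M hM ha, key N hN ((h a le_rfl).1 ha)]
  | add_one γ ih =>
    have hγ : γ < ω_ 1 := lt_of_le_of_lt le_self_add hα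
    have hp := exists_isMaxDecomp hlam hα hM
    have hq := exists_isMaxDecomp hlam hα hN
    rw [maxAverage_add_one, maxAverage_add_one, dif_pos hp, dif_pos hq]
    have hps := hp.choose_spec
    have hqs := hq.choose_spec
    generalize hp.choose = p at hps
    generalize hq.choose = q at hqs
    obtain ⟨n, E⟩ := p
    obtain ⟨m, E'⟩ := q
    obtain ⟨-, hn, hE, hEF⟩ := hps
    obtain ⟨-, hm, hE', hEF'⟩ := hqs
    dsimp only at hn hE hEF hm hE' hEF' ⊢
    obtain rfl : n = m := by rw [hn, hm]; exact minElt_eq_of_agree ha h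
    rw [sum_blocks_eq_of_agree (maxAverage_eq_zero lam γ)
      (fun M hM N hN a ha h => ih hγ hM hN ha h) n E E' M N hE hE' hEF hEF' a ha h]
  | limit γ hγ ih =>
    have hmin := minElt_eq_of_agree ha h
    obtain ⟨h1, hM'⟩ := mem_maxMembers_of_limit hlam hγ hα hM
    obtain ⟨-, hN'⟩ := mem_maxMembers_of_limit hlam hγ hα hN
    have hlt := hlam.lt γ hγ hα _ h1
    rw [maxAverage_limit lam hγ M a hlt, maxAverage_limit lam hγ N a (hmin ▸ hlt), ← hmin]
    rw [← hmin] at hN'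
    exact ih _ hlt (hlt.trans hα) hM' hN' ha h

theorem repeatedAverage_nonneg (lam : Ordinal.{0} → ℕ → Ordinal.{0}) (α : Ordinal.{0})
    (A : Finset ℕ) (a : ℕ) : 0 ≤ repeatedAverage lam α A a := by
  rw [repeatedAverage]
  split_ifs
  · exact maxAverage_nonneg _ _ _ _
  · exact le_rfl

theorem mem_commonInitSeg {A B : Finset ℕ} {a : ℕ} :
    a ∈ commonInitSeg A B ↔ a ∈ A ∧ ∀ b ≤ a, b ∈ A ↔ b ∈ B := by
  simp [commonInitSeg]

theorem commonInitSeg_comm (A B : Finset ℕ) : commonInitSeg A B = commonInitSeg B A := by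
  ext a
  rw [mem_commonInitSeg, mem_commonInitSeg]
  constructor
  · exact fun h => ⟨(h.2 a le_rfl).1 h.1, fun b hb => (h.2 b hb).symm⟩
  · exact fun h => ⟨(h.2 a le_rfl).1 h.1, fun b hb => (h.2 b hb).symm⟩

theorem commonInitSeg_subset (A B : Finset ℕ) : commonInitSeg A B ⊆ A :=
  fun _ h => (mem_commonInitSeg.1 h).1

theorem repeatedAverage_eq_of_mem_commonInitSeg (hlam : IsApproxSystem lam) (hα : α < ω_ 1)
    {A B : Finset ℕ} (hA : A ∈ schreier lam α) (hB : B ∈ schreier lam α) {a : ℕ}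
    (ha : a ∈ commonInitSeg A B) : repeatedAverage lam α A a = repeatedAverage lam α B a := by
  obtain ⟨haA, hag⟩ := mem_commonInitSeg.1 ha
  have haB := (hag a le_rfl).1 haA
  have hA' := (hasRank_schreier hlam α hα).exists_maxMembers hA
  have hB' := (hasRank_schreier hlam α hα).exists_maxMembers hB
  rw [repeatedAverage, repeatedAverage, dif_pos ⟨haA, hA'⟩, dif_pos ⟨haB, hB'⟩]
  obtain ⟨hM, hAM⟩ := hA'.choose_spec
  obtain ⟨hN, hBN⟩ := hB'.choose_spec
  refine maxAverage_eq_of_agree hlam hα hM hN (hAM.1 haA) fun b hb => ?_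
  exact ⟨fun h => hBN.1 ((hag b hb).1 (hAM.2 a haA b h hb)),
    fun h => hAM.1 ((hag b hb).2 (hBN.2 a haB b h hb))⟩

end Families

/-! ### Embeddings from trees of vectors -/

/-- A bounded tree of vectors indexed by `S_α` yields an embedding as soon as, whenever two
branches split, some uniformly bounded functional is large on one of them and at most half as
large on the other. -/
theorem schreierBiLipschitzEmbeds_of_tree {lam : Ordinal.{0} → ℕ → Ordinal.{0}}
    (hlam : IsApproxSystem lam) {α : Ordinal.{0}} (hα : α < ω_ 1)
    {Y : Type*} [NormedAddCommGroup Y] [NormedSpace ℝ Y] (y : Finset ℕ → Y) {R c : ℝ}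
    (hc : 0 < c) (hR : 0 < R) (hy : ∀ A ∈ schreier lam α, ‖y A‖ ≤ R)
    (hF : ∀ A ∈ schreier lam α, ∀ B ∈ schreier lam α, ∃ F : StrongDual ℝ Y, ‖F‖ ≤ R ∧
      (∀ a ∈ A \ commonInitSeg A B, c ≤ F (y (upTo A a))) ∧
      ∀ b ∈ B \ commonInitSeg A B, F (y (upTo B b)) ≤ c / 2) :
    SchreierBiLipschitzEmbeds lam α Y := by
  classical
  set z := repeatedAverage lam α
  have hz := repeatedAverage_nonneg lam α
  set Φ : schreier lam α → Y := fun A => ∑ a ∈ A.1, z A.1 a • y (upTo A.1 a) with hΦ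
  have hS := isSchreierLike_schreier hlam α hα
  have hdiff : ∀ A B : schreier lam α, Φ A - Φ B =
      ∑ a ∈ A.1 \ commonInitSeg A.1 B.1, z A.1 a • y (upTo A.1 a) -
        ∑ b ∈ B.1 \ commonInitSeg A.1 B.1, z B.1 b • y (upTo B.1 b) := by
    intro A B
    have hCB : commonInitSeg A.1 B.1 ⊆ B.1 := by
      rw [commonInitSeg_comm]; exact commonInitSeg_subset _ _
    have hC : ∑ a ∈ commonInitSeg A.1 B.1, z A.1 a • y (upTo A.1 a) =
        ∑ a ∈ commonInitSeg A.1 B.1, z B.1 a • y (upTo B.1 a) := by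
      refine Finset.sum_congr rfl fun a ha => ?_
      have h1 : upTo A.1 a = upTo B.1 a := by
        ext b
        rw [mem_upTo, mem_upTo]
        exact and_congr_left fun hb => (mem_commonInitSeg.1 ha).2 b hb
      rw [h1, show z A.1 a = z B.1 a from
        repeatedAverage_eq_of_mem_commonInitSeg hlam hα A.2 B.2 ha]
    simp only [hΦ]
    rw [← Finset.sum_sdiff (commonInitSeg_subset A.1 B.1), ← Finset.sum_sdiff hCB, hC]
    abel
  have hlow : ∀ A B : schreier lam α,
      c * ∑ a ∈ A.1 \ commonInitSeg A.1 B.1, z A.1 a -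
        c / 2 * ∑ b ∈ B.1 \ commonInitSeg A.1 B.1, z B.1 b ≤ R * ‖Φ A - Φ B‖ := by
    intro A B
    obtain ⟨F, hFR, hFA, hFB⟩ := hF A.1 A.2 B.1 B.2
    have h1 : F (Φ A - Φ B) ≤ R * ‖Φ A - Φ B‖ :=
      (le_abs_self _).trans ((F.le_opNorm _).trans (by gcongr))
    refine le_trans ?_ h1
    rw [hdiff, map_sub, map_sum, map_sum, Finset.mul_sum, Finset.mul_sum]
    refine sub_le_sub (Finset.sum_le_sum fun a ha => ?_) (Finset.sum_le_sum fun b hb => ?_)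
    · rw [map_smul, _root_.smul_eq_mul, mul_comm c]
      exact mul_le_mul_of_nonneg_left (hFA a ha) (hz _ _)
    · rw [map_smul, _root_.smul_eq_mul, mul_comm (c / 2)]
      exact mul_le_mul_of_nonneg_left (hFB b hb) (hz _ _)
  -- Adding the lower estimates for `(A, B)` and `(B, A)` leaves `c / 2` times the distance, at most
  -- `2 * R * ‖Φ A - Φ B‖`.
  refine ⟨Φ, c / (4 * R), R, by positivity, fun A B => ⟨?_, ?_⟩⟩
  · have h1 := hlow A B
    have h2 := hlow B A
    rw [commonInitSeg_comm B.1 A.1, norm_sub_rev] at h2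
    rw [schreierDist]
    change c / (4 * R) * (∑ a ∈ A.1 \ commonInitSeg A.1 B.1, z A.1 a +
      ∑ b ∈ B.1 \ commonInitSeg A.1 B.1, z B.1 b) ≤ _
    rw [div_mul_eq_mul_div, div_le_iff₀ (by positivity)]
    nlinarith [h1, h2]
  · rw [hdiff, schreierDist, mul_add, Finset.mul_sum, Finset.mul_sum]
    refine (norm_sub_le _ _).trans (add_le_add ?_ ?_)
    · refine (norm_sum_le _ _).trans (Finset.sum_le_sum fun a _ => ?_)
      rw [norm_smul, Real.norm_of_nonneg (hz _ _), mul_comm]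
      exact mul_le_mul_of_nonneg_right (hy _ (hS.down _ A.2 _ (upTo_isInitSeg _ _).1)) (hz _ _)
    · refine (norm_sum_le _ _).trans (Finset.sum_le_sum fun a _ => ?_)
      rw [norm_smul, Real.norm_of_nonneg (hz _ _), mul_comm]
      exact mul_le_mul_of_nonneg_right (hy _ (hS.down _ B.2 _ (upTo_isInitSeg _ _).1)) (hz _ _)

/-- Embedding by the vectors `y A` when the functionals `F A` nearly vanish at all vectors outside
the branch of `A`. -/
theorem schreierBiLipschitzEmbeds_of_upper {lam : Ordinal.{0} → ℕ → Ordinal.{0}}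
    (hlam : IsApproxSystem lam) {α : Ordinal.{0}} (hα : α < ω_ 1)
    {Y : Type*} [NormedAddCommGroup Y] [NormedSpace ℝ Y] (y : Finset ℕ → Y)
    (F : Finset ℕ → StrongDual ℝ Y) {R c : ℝ} (hc : 0 < c) (hR : 0 < R)
    (hy : ∀ A ∈ schreier lam α, ‖y A‖ ≤ R) (hF : ∀ A ∈ schreier lam α, ‖F A‖ ≤ R)
    (h1 : ∀ A ∈ schreier lam α, ∀ D ∈ schreier lam α, D.Nonempty → IsInitSeg D A → c ≤ F A (y D))
    (h2 : ∀ A ∈ schreier lam α, ∀ D ∈ schreier lam α, D.Nonempty → ¬ IsInitSeg D A →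
      F A (y D) ≤ c / 2) :
    SchreierBiLipschitzEmbeds lam α Y := by
  have hS := isSchreierLike_schreier hlam α hα
  refine schreierBiLipschitzEmbeds_of_tree hlam hα y hc hR hy fun A hA B hB =>
    ⟨F A, hF A hA, fun a ha => ?_, fun b hb => ?_⟩
  · rw [Finset.mem_sdiff] at ha
    have hi := upTo_isInitSeg A a
    exact h1 A hA _ (hS.down A hA _ hi.1) ⟨a, mem_upTo.2 ⟨ha.1, le_rfl⟩⟩ hi
  · rw [Finset.mem_sdiff] at hb
    have hbb : b ∈ upTo B b := mem_upTo.2 ⟨hb.1, le_rfl⟩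
    have hi := upTo_isInitSeg B b
    refine h2 A hA _ (hS.down B hB _ hi.1) ⟨b, hbb⟩ fun hBA => hb.2 ?_
    refine mem_commonInitSeg.2 ⟨hBA.1 hbb, fun d hd => ?_⟩
    exact ⟨fun h => hi.1 (hBA.2 b hbb d h hd), fun h => hBA.1 (hi.2 b hbb d h hd)⟩

/-- Embedding by the vectors `y A` when the functionals `F D` nearly vanish at all vectors outside
the subtree above `D`. -/
theorem schreierBiLipschitzEmbeds_of_lower {lam : Ordinal.{0} → ℕ → Ordinal.{0}}
    (hlam : IsApproxSystem lam) {α : Ordinal.{0}} (hα : α < ω_ 1)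
    {Y : Type*} [NormedAddCommGroup Y] [NormedSpace ℝ Y] (y : Finset ℕ → Y)
    (F : Finset ℕ → StrongDual ℝ Y) {R c : ℝ} (hc : 0 < c) (hR : 0 < R)
    (hy : ∀ A ∈ schreier lam α, ‖y A‖ ≤ R) (hF : ∀ A ∈ schreier lam α, ‖F A‖ ≤ R)
    (h1 : ∀ A ∈ schreier lam α, ∀ D ∈ schreier lam α, D.Nonempty → IsInitSeg D A → c ≤ F D (y A))
    (h2 : ∀ A ∈ schreier lam α, ∀ D ∈ schreier lam α, D.Nonempty → ¬ IsInitSeg D A →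
      F D (y A) ≤ c / 2) :
    SchreierBiLipschitzEmbeds lam α Y := by
  have hS := isSchreierLike_schreier hlam α hα
  refine schreierBiLipschitzEmbeds_of_tree hlam hα y hc hR hy fun A hA B hB => ?_
  by_cases hne : (A \ commonInitSeg A B).Nonempty
  · have he := minElt_mem hne
    -- At `e` the branch of `A` leaves that of `B`: all later nodes of `A` extend `upTo A e`, and no
    -- node of `B` does.
    set e := minElt (A \ commonInitSeg A B) with hedef
    rw [Finset.mem_sdiff] at he
    have hee : e ∈ upTo A e := mem_upTo.2 ⟨he.1, le_rfl⟩
    have hi := upTo_isInitSeg A e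
    have hE := hS.down A hA _ hi.1
    refine ⟨F (upTo A e), hF _ hE, fun a ha => ?_, fun b hb => ?_⟩
    · have hea : e ≤ a := minElt_le ha
      refine h1 _ (hS.down A hA _ (upTo_isInitSeg A a).1) _ hE ⟨e, hee⟩
        ⟨fun x hx => ?_, fun x hx w hw hwx => ?_⟩
      · exact mem_upTo.2 ⟨hi.1 hx, (mem_upTo.1 hx).2.trans hea⟩
      · exact hi.2 x hx w (mem_upTo.1 hw).1 hwx
    · refine h2 _ (hS.down B hB _ (upTo_isInitSeg B b).1) _ hE ⟨e, hee⟩ fun h => he.2 ?_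
      have hB' := h.trans (upTo_isInitSeg B b)
      refine mem_commonInitSeg.2 ⟨he.1, fun d hd => ?_⟩
      exact ⟨fun h => hB'.1 (hi.2 e hee d h hd), fun h => hi.1 (hB'.2 e hee d h hd)⟩
  -- Here `A` is an initial segment of `B`; nothing is required on the side of `A`, so the zero
  -- functional works.
  · refine ⟨0, by simpa using hR.le, fun a ha => absurd ⟨a, ha⟩ hne, fun b _ => ?_⟩
    simpa using (half_pos hc).le

/-! ### Weak-* approximation -/

section FunctionalAnalysis

variable {Z : Type*} [NormedAddCommGroup Z] [NormedSpace ℝ Z]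

theorem tendsto_toWeakDual_iff {u : ℕ → StrongDual ℝ Z} {f : StrongDual ℝ Z} :
    Tendsto (fun n => StrongDual.toWeakDual (u n)) atTop (𝓝 (StrongDual.toWeakDual f)) ↔
      ∀ z, Tendsto (fun n => u n z) atTop (𝓝 (f z)) := by
  rw [tendsto_iff_forall_eval_tendsto_topDualPairing]
  rfl

theorem exists_lt_apply_of_lt_norm {f : StrongDual ℝ Z} {r : ℝ} (h : r < ‖f‖) :
    ∃ z : Z, ‖z‖ ≤ 1 ∧ r < f z := by
  obtain ⟨z, hz, hr⟩ := f.exists_lt_apply_of_lt_opNorm h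
  rcases abs_cases (f z) with ⟨h1, -⟩ | ⟨h1, -⟩
  · exact ⟨z, hz.le, by rwa [Real.norm_eq_abs, h1] at hr⟩
  · exact ⟨-z, by simpa using hz.le, by rw [map_neg]; rwa [Real.norm_eq_abs, h1] at hr⟩

theorem norm_le_of_forall_apply_le {f : StrongDual ℝ Z} {r : ℝ} (hr : 0 ≤ r)
    (h : ∀ z, f z ≤ r * ‖z‖) : ‖f‖ ≤ r := by
  refine f.opNorm_le_bound hr fun z => abs_le.2 ⟨?_, h z⟩
  have := h (-z)
  rw [map_neg, norm_neg] at this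
  linarith

/-- Goldstine's theorem: on finitely many functionals, a member of the unit ball of the bidual is
approximated by a member of the unit ball of the space. -/
theorem exists_norm_le_one_forall_abs_sub_le (g : StrongDual ℝ (StrongDual ℝ Z)) (hg : ‖g‖ ≤ 1)
    (s : Finset (StrongDual ℝ Z)) {δ : ℝ} (hδ : 0 < δ) :
    ∃ u : Z, ‖u‖ ≤ 1 ∧ ∀ z ∈ s, |z u - g z| ≤ δ := by
  classical
  set T : Z →L[ℝ] (s → ℝ) := ContinuousLinearMap.pi fun z : s => z.1 with hT
  set v : s → ℝ := fun z => g z.1 with hv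
  by_cases hmem : v ∈ closure (T '' Metric.closedBall 0 1)
  · obtain ⟨_, ⟨u, hu, rfl⟩, hdist⟩ := Metric.mem_closure_iff.1 hmem δ hδ
    refine ⟨u, by simpa using hu, fun z hz => ?_⟩
    have h := (dist_le_pi_dist v (T u) ⟨z, hz⟩).trans hdist.le
    rwa [dist_comm, Real.dist_eq] at h
  · obtain ⟨f, r, h1, h2⟩ := geometric_hahn_banach_closed_point
      (((convex_closedBall (0 : Z) 1).linear_image T.toLinearMap).closure) isClosed_closure hmem
    -- The separating functional on the finite-dimensional space, pulled back to `Z`, is a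
    -- combination `ψ` of members of `s`. Separation makes `g ψ` exceed the supremum of `ψ` on the
    -- ball, contrary to `‖g‖ ≤ 1`.
    set ψ : StrongDual ℝ Z := ∑ z : s, f (Pi.single z 1) • z.1 with hψ
    have hf : ∀ a : s → ℝ, f a = ∑ z, a z * f (Pi.single z 1) := by
      intro a
      conv_lhs => rw [pi_eq_sum_univ' a]
      rw [map_sum]
      refine Finset.sum_congr rfl fun z _ => ?_
      rw [map_smul, _root_.smul_eq_mul]
    have hfT : ∀ u, f (T u) = ψ u := by
      intro u
      rw [hf, hψ, _root_.sum_apply]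
      refine Finset.sum_congr rfl fun z _ => ?_
      simp [hT, mul_comm]
    have hfv : f v = g ψ := by
      rw [hf, hψ, map_sum]
      refine Finset.sum_congr rfl fun z _ => ?_
      simp [hv, mul_comm]
    have hle : g ψ ≤ ‖ψ‖ := (le_abs_self _).trans
      ((g.le_opNorm ψ).trans (mul_le_of_le_one_left (norm_nonneg _) hg))
    obtain ⟨u, hu, hru⟩ := exists_lt_apply_of_lt_norm (h2.trans_le (hfv.trans_le hle))
    have := h1 (T u) (subset_closure ⟨u, by simpa using hu, rfl⟩)
    rw [hfT] at this
    exact absurd this hru.not_gt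

/-- Helly's theorem: a functional far from the span of finitely many functionals is large somewhere
on their common kernel. -/
theorem exists_apply_eq_zero_and_le (H : Finset (StrongDual ℝ Z)) (w : StrongDual ℝ Z) {η : ℝ}
    (hη : 0 < η) (hw : ∀ h ∈ Submodule.span ℝ (H : Set (StrongDual ℝ Z)), η ≤ ‖w - h‖) :
    ∃ x : Z, ‖x‖ ≤ 1 ∧ (∀ h ∈ H, h x = 0) ∧ η / 2 ≤ w x := by
  set M : Submodule ℝ Z := ⨅ h : H, LinearMap.ker (h.1 : Z →ₗ[ℝ] ℝ) with hM
  -- If `g` is a norm-preserving extension of `w` restricted to the common kernel, `w - g` lies in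
  -- the span, so the restriction has norm `‖w - (w - g)‖ ≥ η`.
  obtain ⟨g, hg, hgn⟩ := exists_extension_norm_eq M (w.comp M.subtypeL)
  have hspan : w - g ∈ Submodule.span ℝ (H : Set (StrongDual ℝ Z)) := by
    have h1 : ((w - g : StrongDual ℝ Z) : Z →ₗ[ℝ] ℝ) ∈
        Submodule.span ℝ (range fun h : H => (h.1 : Z →ₗ[ℝ] ℝ)) := by
      refine mem_span_of_iInf_ker_le_ker fun x hx => ?_
      have := hg ⟨x, hx⟩
      simp only [ContinuousLinearMap.comp_apply, Submodule.subtypeL_apply] at this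
      simp [this]
    obtain ⟨c, hc⟩ := (Submodule.mem_span_range_iff_exists_fun ℝ).1 h1
    have h2 : w - g = ∑ h : H, c h • h.1 := by
      ext x
      have := LinearMap.congr_fun hc x
      simpa using this.symm
    rw [h2]
    exact Submodule.sum_mem _ fun h _ => Submodule.smul_mem _ _ (Submodule.subset_span h.2)
  have hn := hw _ hspan
  rw [sub_sub_cancel, hgn] at hn
  obtain ⟨x, hx, hlt⟩ := exists_lt_apply_of_lt_norm (f := w.comp M.subtypeL)
    ((half_lt_self hη).trans_le hn)
  refine ⟨x, hx, fun h hh => ?_, hlt.le⟩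
  exact (Submodule.mem_iInf _).1 x.2 ⟨h, hh⟩

/-- Otherwise approximants from `V` at distance below `ε / 3` would, by compactness, converge in
norm along a subsequence to some `l`. Weak-* nullity gives `‖l‖ ≤ ε / 3`, while `‖w n‖ ≥ ε` gives
`‖l‖ ≥ 2 * ε / 3`. -/
theorem eventually_le_norm_sub_of_weakStar_null {w : ℕ → StrongDual ℝ Z} {ε R : ℝ} (hε : 0 < ε)
    (hw0 : ∀ z, Tendsto (fun n => w n z) atTop (𝓝 0)) (hwε : ∀ n, ε ≤ ‖w n‖)
    (hwR : ∀ n, ‖w n‖ ≤ R) (V : Submodule ℝ (StrongDual ℝ Z)) [FiniteDimensional ℝ V] :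
    ∀ᶠ n in atTop, ∀ h ∈ V, ε / 3 ≤ ‖w n - h‖ := by
  by_contra hcon
  rw [not_eventually] at hcon
  obtain ⟨φ, hφ, hφP⟩ := extraction_of_frequently_atTop hcon
  push Not at hφP
  choose h hhV hh using hφP
  have : ProperSpace V := FiniteDimensional.proper_real V
  obtain ⟨l, -, ψ, hψ, hl⟩ := tendsto_subseq_of_bounded
    (Metric.isBounded_closedBall (x := (0 : V)) (r := R + ε / 3)) (x := fun n => ⟨h n, hhV n⟩)
    fun n => by
      change dist (h n) 0 ≤ _
      rw [dist_zero_right]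
      have h1 : h n = w (φ n) - (w (φ n) - h n) := by abel
      rw [h1]
      exact (norm_sub_le _ _).trans (add_le_add (hwR _) (hh n).le)
  have hl' : Tendsto (fun n => h (ψ n)) atTop (𝓝 (l : StrongDual ℝ Z)) :=
    (continuous_subtype_val.tendsto l).comp hl
  have hln : ‖(l : StrongDual ℝ Z)‖ ≤ ε / 3 := by
    refine norm_le_of_forall_apply_le (by positivity) fun z => ?_
    have h1 : Tendsto (fun n => h (ψ n) z) atTop (𝓝 ((l : StrongDual ℝ Z) z)) :=
      ((ContinuousLinearMap.apply ℝ ℝ z).continuous.tendsto _).comp hl'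
    have h2 : Tendsto (fun n => w (φ (ψ n)) z) atTop (𝓝 0) :=
      (hw0 z).comp (hφ.tendsto_atTop.comp hψ.tendsto_atTop)
    have h3 := h1.sub h2
    rw [_root_.sub_zero] at h3
    refine le_of_tendsto' h3 fun n => ?_
    rw [← _root_.sub_apply]
    refine (le_abs_self _).trans
      ((ContinuousLinearMap.le_opNorm (h (ψ n) - w (φ (ψ n))) z).trans ?_)
    rw [norm_sub_rev]
    exact mul_le_mul_of_nonneg_right (hh _).le (norm_nonneg z)
  have hfin : ε ≤ ε / 3 + ‖(l : StrongDual ℝ Z)‖ := by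
    refine ge_of_tendsto' (hl'.norm.const_add (ε / 3)) fun n => ?_
    have h1 : w (φ (ψ n)) = (w (φ (ψ n)) - h (ψ n)) + h (ψ n) := by abel
    calc ε ≤ ‖w (φ (ψ n))‖ := hwε _
      _ ≤ ‖w (φ (ψ n)) - h (ψ n)‖ + ‖h (ψ n)‖ := by
          conv_lhs => rw [h1]
          exact norm_add_le _ _
      _ ≤ _ := by gcongr; exact (hh _).le
  linarith

/-! ### Iterated derived sets of the unit ball -/

theorem szlenkDeriv_mono {ε : ℝ} {K L : Set (StrongDual ℝ Z)} (h : K ⊆ L) :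
    szlenkDeriv Z ε K ⊆ szlenkDeriv Z ε L :=
  fun _ ⟨u, hu, h'⟩ => ⟨u, fun n => h (hu n), h'⟩

theorem szlenkDeriv_closedBall_subset (ε : ℝ) :
    szlenkDeriv Z ε (Metric.closedBall 0 1) ⊆ Metric.closedBall 0 1 := by
  rintro f ⟨u, hu, hlim, -⟩
  rw [tendsto_toWeakDual_iff] at hlim
  rw [mem_closedBall_zero_iff]
  refine norm_le_of_forall_apply_le zero_le_one fun z => le_of_tendsto' (hlim z) fun n => ?_
  refine (le_abs_self _).trans (((u n).le_opNorm z).trans ?_)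
  exact mul_le_mul_of_nonneg_right (by simpa using hu n) (norm_nonneg z)

/-- The derivation also admits limits outside the set, so the iterates decrease only because the
ball is weak-* sequentially closed. -/
theorem szlenkIter_add_one_subset (ε : ℝ) (α : Ordinal.{0}) :
    szlenkIter Z ε (Metric.closedBall 0 1) (α + 1) ⊆
      szlenkIter Z ε (Metric.closedBall 0 1) α := by
  induction α using Ordinal.limitRecOn with
  | zero =>
    rw [szlenkIter_add_one, szlenkIter_zero]
    exact szlenkDeriv_closedBall_subset ε
  | add_one γ ih =>
    rw [szlenkIter_add_one, szlenkIter_add_one Z ε _ γ]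
    rw [szlenkIter_add_one] at ih
    exact szlenkDeriv_mono ih
  | limit γ hγ ih =>
    rw [szlenkIter_add_one]
    intro f hf
    rw [szlenkIter_limit _ _ _ _ hγ]
    refine mem_iInter₂.2 fun β hβ => ih β hβ ?_
    rw [szlenkIter_add_one]
    refine szlenkDeriv_mono ?_ hf
    rw [szlenkIter_limit _ _ _ _ hγ]
    exact iInter₂_subset β hβ

theorem szlenkIter_anti (ε : ℝ) {α β : Ordinal.{0}} (h : α ≤ β) :
    szlenkIter Z ε (Metric.closedBall 0 1) β ⊆ szlenkIter Z ε (Metric.closedBall 0 1) α := by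
  induction β using Ordinal.limitRecOn with
  | zero => rw [nonpos_iff_eq_zero.1 h]
  | add_one γ ih =>
    rcases h.eq_or_lt with rfl | hlt
    · exact subset_rfl
    · exact (szlenkIter_add_one_subset ε γ).trans (ih (Order.lt_add_one_iff.1 hlt))
  | limit γ hγ ih =>
    rcases h.eq_or_lt with rfl | hlt
    · exact subset_rfl
    · rw [szlenkIter_limit _ _ _ _ hγ]
      exact iInter₂_subset α hlt

theorem norm_le_one_of_mem_szlenkIter {ε : ℝ} {α : Ordinal.{0}} {f : StrongDual ℝ Z}
    (hf : f ∈ szlenkIter Z ε (Metric.closedBall 0 1) α) : ‖f‖ ≤ 1 := by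
  have := szlenkIter_anti ε (zero_le (a := α)) hf
  rwa [szlenkIter_zero, mem_closedBall_zero_iff] at this

theorem exists_mem_szlenkIter_of_lt {α : Ordinal.{0}} (h : α < szlenkIndex Z) :
    ∃ ε : ℝ, 0 < ε ∧ (szlenkIter Z ε (Metric.closedBall 0 1) α).Nonempty := by
  have : Nonempty {ε : ℝ // 0 < ε} := ⟨⟨1, one_pos⟩⟩
  obtain ⟨⟨ε, hε⟩, h1⟩ := exists_lt_of_lt_ciSup h
  refine ⟨ε, hε, ?_⟩
  -- An empty set of orders would have supremum `0`, which is not above `α`.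
  have hne : {α : Ordinal.{0} | α < ω_ 1 ∧
      (szlenkIter Z ε (Metric.closedBall (0 : StrongDual ℝ Z) 1) α).Nonempty}.Nonempty := by
    by_contra hemp
    rw [not_nonempty_iff_eq_empty] at hemp
    simp only [hemp, csSup_empty] at h1
    exact not_lt_bot h1
  obtain ⟨β, ⟨-, hβ⟩, hlt⟩ := exists_lt_of_lt_csSup hne h1
  exact hβ.mono (szlenkIter_anti ε hlt.le)

/-- A sequence witnessing `p` in the derived set differs from `p` by a weak-* null sequence, which
is eventually `ε / 3` away from the span of `H`; Helly's theorem halves this to `ε / 6`. Since `p ∈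
H` vanishes at `x`, the bound passes from `g - p` to `g`. -/
theorem exists_mem_szlenkIter_near {ε : ℝ} (hε : 0 < ε) {β : Ordinal.{0}} {p : StrongDual ℝ Z}
    (hp : p ∈ szlenkIter Z ε (Metric.closedBall 0 1) (β + 1)) (H : Finset (StrongDual ℝ Z))
    (hpH : p ∈ H) (s : Finset Z) {δ : ℝ} (hδ : 0 < δ) :
    ∃ g ∈ szlenkIter Z ε (Metric.closedBall 0 1) β, ∃ x : Z, ‖x‖ ≤ 1 ∧ (∀ h ∈ H, h x = 0) ∧
      ε / 6 ≤ g x ∧ ∀ z ∈ s, |g z - p z| ≤ δ := by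
  have hp1 := norm_le_one_of_mem_szlenkIter hp
  rw [szlenkIter_add_one] at hp
  obtain ⟨u, hu, hlim, hfar⟩ := hp
  rw [tendsto_toWeakDual_iff] at hlim
  have hw0 : ∀ z, Tendsto (fun n => (u n - p) z) atTop (𝓝 0) := fun z => by
    simpa using (hlim z).sub_const (p z)
  have : FiniteDimensional ℝ (Submodule.span ℝ (H : Set (StrongDual ℝ Z))) :=
    FiniteDimensional.span_finset ℝ H
  have h1 := eventually_le_norm_sub_of_weakStar_null hε hw0 (fun n => (hfar n).le) (R := 1 + 1)
    (fun n => (norm_sub_le _ _).trans (add_le_add (norm_le_one_of_mem_szlenkIter (hu n)) hp1))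
    (Submodule.span ℝ (H : Set (StrongDual ℝ Z)))
  have h2 : ∀ᶠ n in atTop, ∀ z ∈ s, |(u n - p) z| ≤ δ := by
    rw [Filter.eventually_all_finset]
    intro z _
    have := (hw0 z).abs
    rw [abs_zero] at this
    exact this.eventually_le_const hδ
  obtain ⟨n, hn1, hn2⟩ := (h1.and h2).exists
  obtain ⟨x, hx, hx0, hxg⟩ := exists_apply_eq_zero_and_le H (u n - p) (by positivity) hn1
  refine ⟨u n, hu n, x, hx, hx0, ?_, hn2⟩
  rw [_root_.sub_apply, hx0 p hpH, _root_.sub_zero] at hxg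
  linarith

end FunctionalAnalysis

/-! ### The tree construction -/

/-- Dependent choice where each term may use all earlier ones; by `hloc` the default values beyond
the history do not matter. -/
theorem exists_seq_of_history {D : Type*} [Inhabited D] (P : ℕ → (ℕ → D) → D → Prop)
    (hloc : ∀ n s t d, (∀ m < n, s m = t m) → P n s d → P n t d)
    (hex : ∀ n s, (∀ m < n, P m s (s m)) → ∃ d, P n s d) : ∃ s : ℕ → D, ∀ n, P n s (s n) := by
  classical
  let ext : ∀ n : ℕ, (∀ m < n, D) → ℕ → D := fun n r m => if h : m < n then r m h else default
  let s : ℕ → D := fun n => Nat.strongRecOn n fun n r =>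
    if h : ∃ d, P n (ext n r) d then h.choose else default
  have hs : ∀ n, s n = if h : ∃ d, P n (ext n fun m _ => s m) d then h.choose else default := by
    intro n
    simp only [s]
    rw [Nat.strongRecOn_eq]
  refine ⟨s, fun n => ?_⟩
  induction n using Nat.strong_induction_on with
  | _ n ih =>
    have hagree : ∀ m < n, s m = ext n (fun m _ => s m) m := fun m hm => by simp [ext, hm]
    obtain ⟨d, hd⟩ := hex n s ih
    have h : ∃ d, P n (ext n fun m _ => s m) d := ⟨d, hloc n _ _ d hagree hd⟩
    rw [hs n, dif_pos h]
    exact hloc n _ _ _ (fun m hm => (hagree m hm).symm) h.choose_spec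

/-- The code of a finite set in the colexicographic enumeration. -/
def binaryCode (A : Finset ℕ) : ℕ := ∑ i ∈ A, 2 ^ i

theorem binaryCode_equivBitIndices (n : ℕ) : binaryCode (Finset.equivBitIndices n) = n :=
  Finset.equivBitIndices.symm_apply_apply n

theorem equivBitIndices_binaryCode (A : Finset ℕ) : Finset.equivBitIndices (binaryCode A) = A :=
  Finset.equivBitIndices.apply_symm_apply A

theorem binaryCode_le {A B : Finset ℕ} (h : A ⊆ B) : binaryCode A ≤ binaryCode B :=
  Finset.sum_le_sum_of_subset h

/-- Hence the enumeration by codes treats every proper initial segment before its extensions. -/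
theorem binaryCode_lt {A B : Finset ℕ} (h : A ⊆ B) (hne : A ≠ B) :
    binaryCode A < binaryCode B := by
  refine (binaryCode_le h).lt_of_ne fun heq => hne ?_
  rw [← equivBitIndices_binaryCode A, heq, equivBitIndices_binaryCode]

/-- The immediate predecessor of `A` in the end-extension order. -/
def endPred (A : Finset ℕ) : Finset ℕ := A.erase (A.sup id)

theorem sup_id_mem {A : Finset ℕ} (hA : A.Nonempty) : A.sup id ∈ A := by
  obtain ⟨a, ha, h⟩ := Finset.exists_mem_eq_sup A hA id
  rw [h]; exact ha

theorem endPred_isInitSeg (A : Finset ℕ) : IsInitSeg (endPred A) A := by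
  refine ⟨Finset.erase_subset _ _, fun a ha b hb hba => Finset.mem_erase.2 ⟨?_, hb⟩⟩
  rintro rfl
  obtain ⟨h1, h2⟩ := Finset.mem_erase.1 ha
  exact h1 (le_antisymm (Finset.le_sup (f := id) h2) hba)

theorem endPred_ne {A : Finset ℕ} (hA : A.Nonempty) : endPred A ≠ A := fun h =>
  Finset.erase_eq_self.1 h (sup_id_mem hA)

theorem isInitSeg_endPred {A D : Finset ℕ} (h : IsInitSeg D A) (hne : D ≠ A) :
    IsInitSeg D (endPred A) := by
  refine ⟨fun d hd => Finset.mem_erase.2 ⟨?_, h.1 hd⟩,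
    fun a ha b hb hba => h.2 a ha b (Finset.mem_of_mem_erase hb) hba⟩
  rintro rfl
  exact hne (Finset.Subset.antisymm h.1 fun b hb => h.2 _ hd b hb (Finset.le_sup (f := id) hb))

/-- Induction along the codes. The error from `g (endPred A)` to `g A` is geometric in the code, so
that errors along a branch stay summable; `f A` approximates `g A` directly, so its error `δ` does
not accumulate. -/
theorem exists_tree_sequence {Z : Type*} [NormedAddCommGroup Z] [NormedSpace ℝ Z]
    {W : Set (StrongDual ℝ Z)}
    (hW : ∀ g : StrongDual ℝ Z, ‖g‖ ≤ 1 → ∀ (s : Finset Z) (δ : ℝ), 0 < δ →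
      ∃ f ∈ W, ∀ z ∈ s, |f z - g z| ≤ δ)
    {T : Set (Finset ℕ)} (hT : ∀ A ∈ T, ∀ B ⊆ A, B ∈ T) {o : Ordinal.{0}} (hrank : HasRank T o)
    {ε δ : ℝ} (hε : 0 < ε) (hδ : 0 < δ)
    (hK : (szlenkIter Z ε (Metric.closedBall 0 1) o).Nonempty) :
    ∃ (f g : Finset ℕ → StrongDual ℝ Z) (x : Finset ℕ → Z), ∀ A ∈ T,
      f A ∈ W ∧ ‖x A‖ ≤ 1 ∧
      (∀ B, binaryCode B < binaryCode A → g B (x A) = 0 ∧ f B (x A) = 0) ∧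
      (∀ B, binaryCode B ≤ binaryCode A → |f A (x B) - g A (x B)| ≤ δ) ∧
      (A.Nonempty → ε / 6 ≤ g A (x A) ∧ ∀ B, binaryCode B < binaryCode A →
        |g A (x B) - g (endPred A) (x B)| ≤ δ * (1 / 2) ^ binaryCode A) := by
  classical
  obtain ⟨ρ, hρ0, hρ⟩ := hrank
  obtain ⟨g0, hg0⟩ := hK
  replace hg0 := szlenkIter_anti ε hρ0 hg0
  let E : ℕ → Finset ℕ := Finset.equivBitIndices
  -- The data at a node are the triple `(g, f, x)`.
  let Q : ℕ → (ℕ → StrongDual ℝ Z × StrongDual ℝ Z × Z) →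
      StrongDual ℝ Z × StrongDual ℝ Z × Z → Prop := fun n s d => E n ∈ T →
    d.1 ∈ szlenkIter Z ε (Metric.closedBall 0 1) (ρ (E n)) ∧ d.2.1 ∈ W ∧ ‖d.2.2‖ ≤ 1 ∧
    (∀ m < n, (s m).1 d.2.2 = 0 ∧ (s m).2.1 d.2.2 = 0) ∧
    (∀ m < n, |d.2.1 (s m).2.2 - d.1 (s m).2.2| ≤ δ) ∧ |d.2.1 d.2.2 - d.1 d.2.2| ≤ δ ∧
    ((E n).Nonempty → ε / 6 ≤ d.1 d.2.2 ∧ ∀ m < n,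
      |d.1 (s m).2.2 - (s (binaryCode (endPred (E n)))).1 (s m).2.2| ≤ δ * (1 / 2) ^ n)
  have hpred : ∀ n, (E n).Nonempty → binaryCode (endPred (E n)) < n := fun n hn => by
    conv_rhs => rw [← binaryCode_equivBitIndices n]
    exact binaryCode_lt (endPred_isInitSeg _).1 (endPred_ne hn)
  have : Inhabited (StrongDual ℝ Z × StrongDual ℝ Z × Z) := ⟨0⟩
  obtain ⟨s, hs⟩ : ∃ s, ∀ n, Q n s (s n) := by
    refine exists_seq_of_history Q ?_ ?_
    · intro n s t d hst h hn
      obtain ⟨h1, h2, h3, h4, h5, h6, h7⟩ := h hn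
      refine ⟨h1, h2, h3, fun m hm => hst m hm ▸ h4 m hm, fun m hm => hst m hm ▸ h5 m hm, h6,
        fun hne => ⟨(h7 hne).1, fun m hm => ?_⟩⟩
      rw [← hst m hm, ← hst _ (hpred n hne)]
      exact (h7 hne).2 m hm
    · intro n s hprev
      by_cases hn : E n ∈ T
      swap
      · exact ⟨default, fun h => absurd h hn⟩
      let X : Finset Z := (Finset.range n).image fun m => (s m).2.2
      have hX : ∀ m < n, (s m).2.2 ∈ X := fun m hm =>
        Finset.mem_image.2 ⟨m, Finset.mem_range.2 hm, rfl⟩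
      by_cases hne : (E n).Nonempty
      · have hp := hpred n hne
        have hpE : E (binaryCode (endPred (E n))) = endPred (E n) := equivBitIndices_binaryCode _
        have hpT : endPred (E n) ∈ T := hT _ hn _ (endPred_isInitSeg _).1
        obtain ⟨hgp, -⟩ := hprev _ hp (hpE.symm ▸ hpT)
        rw [hpE] at hgp
        -- The rank drops strictly from `endPred A` to `A`, so the old functional survives one
        -- derivation more than is asked of the new one.
        replace hgp := szlenkIter_anti ε (Order.add_one_le_of_lt
          (hρ _ hpT _ hn (endPred_isInitSeg _) (endPred_ne hne))) hgp
        let H : Finset (StrongDual ℝ Z) := ((Finset.range n).image fun m => (s m).1) ∪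
          (Finset.range n).image fun m => (s m).2.1
        have hH : ∀ m < n, (s m).1 ∈ H ∧ (s m).2.1 ∈ H := fun m hm =>
          ⟨Finset.mem_union_left _ (Finset.mem_image.2 ⟨m, Finset.mem_range.2 hm, rfl⟩),
            Finset.mem_union_right _ (Finset.mem_image.2 ⟨m, Finset.mem_range.2 hm, rfl⟩)⟩
        obtain ⟨g, hg, x, hx, hx0, hgx, hgX⟩ := exists_mem_szlenkIter_near hε hgp H (hH _ hp).1 X
          (δ := δ * (1 / 2) ^ n) (by positivity)
        obtain ⟨f, hf, hfg⟩ := hW g (norm_le_one_of_mem_szlenkIter hg) (insert x X) δ hδ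
        exact ⟨(g, f, x), fun _ => ⟨hg, hf, hx, fun m hm => ⟨hx0 _ (hH m hm).1, hx0 _ (hH m hm).2⟩,
          fun m hm => hfg _ (Finset.mem_insert_of_mem (hX m hm)),
          hfg _ (Finset.mem_insert_self _ _), fun _ => ⟨hgx, fun m hm => hgX _ (hX m hm)⟩⟩⟩
      -- At the root no lower bound is required, so the point may be `0`.
      · rw [Finset.not_nonempty_iff_eq_empty] at hne
        obtain ⟨f, hf, hfg⟩ := hW g0 (norm_le_one_of_mem_szlenkIter hg0) X δ hδ
        exact ⟨(g0, f, 0), fun _ => ⟨hne ▸ hg0, hf, by simp, fun m _ => by simp,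
          fun m hm => hfg _ (hX m hm), by simpa using hδ.le, fun h => by simp [hne] at h⟩⟩
  refine ⟨fun A => (s (binaryCode A)).2.1, fun A => (s (binaryCode A)).1,
    fun A => (s (binaryCode A)).2.2, fun A hA => ?_⟩
  have hE : E (binaryCode A) = A := equivBitIndices_binaryCode A
  obtain ⟨-, h2, h3, h4, h5, h6, h7⟩ := hs (binaryCode A) (hE.symm ▸ hA)
  rw [hE] at h7
  refine ⟨h2, h3, fun B hB => h4 _ hB, fun B hB => ?_,
    fun hne => ⟨(h7 hne).1, fun B hB => (h7 hne).2 _ hB⟩⟩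
  rcases hB.eq_or_lt with heq | hlt
  · simpa only [heq] using h6
  · exact h5 _ hlt

/-- Points and functionals indexed by a ranked tree such that `f A (x D)` is large if `D` is an
initial segment of `A` and small otherwise; the functionals come from a weak-* dense part of the
unit ball. -/
theorem exists_almost_triangular {Z : Type*} [NormedAddCommGroup Z] [NormedSpace ℝ Z]
    {W : Set (StrongDual ℝ Z)}
    (hW : ∀ g : StrongDual ℝ Z, ‖g‖ ≤ 1 → ∀ (s : Finset Z) (δ : ℝ), 0 < δ →
      ∃ f ∈ W, ∀ z ∈ s, |f z - g z| ≤ δ)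
    {T : Set (Finset ℕ)} (hT : ∀ A ∈ T, ∀ B ⊆ A, B ∈ T) {o : Ordinal.{0}} (hrank : HasRank T o)
    (ho : o < szlenkIndex Z) :
    ∃ (f : Finset ℕ → StrongDual ℝ Z) (x : Finset ℕ → Z) (c : ℝ), 0 < c ∧
      (∀ A ∈ T, f A ∈ W) ∧ (∀ A ∈ T, ‖x A‖ ≤ 1) ∧
      ∀ A ∈ T, ∀ D ∈ T, D.Nonempty →
        (IsInitSeg D A → c ≤ f A (x D)) ∧ (¬ IsInitSeg D A → f A (x D) ≤ c / 2) := by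
  obtain ⟨ε, hε, hK⟩ := exists_mem_szlenkIter_of_lt ho
  -- One `δ` is lost along the branch and one in passing from `g` to `f`: `ε / 6 - 2 * δ = ε / 8`,
  -- and `2 * δ = ε / 24` is below half of it.
  obtain ⟨δ, hδε⟩ : ∃ δ, δ = ε / 48 := ⟨_, rfl⟩
  have hδ : 0 < δ := by rw [hδε]; positivity
  obtain ⟨f, g, x, hfgx⟩ := exists_tree_sequence hW hT hrank hε hδ hK
  -- If `D` comes after `A`, then `g A` kills `x D`. If `D` comes before, `g A` is compared with `g
  -- (endPred A)`: for codes `m < n` of `endPred A` and `A`, the error `δ * (1 - (1 / 2) ^ m)` plus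
  -- `δ * (1 / 2) ^ n` is at most `δ * (1 - (1 / 2) ^ n)`.
  have key : ∀ n A, binaryCode A = n → A ∈ T → ∀ D ∈ T, D.Nonempty →
      (IsInitSeg D A → ε / 6 - δ * (1 - (1 / 2) ^ n) ≤ g A (x D)) ∧
      (¬ IsInitSeg D A → |g A (x D)| ≤ δ * (1 - (1 / 2) ^ n)) := by
    intro n
    induction n using Nat.strong_induction_on with
    | _ n ih =>
      intro A hAn hA D hD hDne
      have hpow : (1 / 2 : ℝ) ^ n ≤ 1 := pow_le_one₀ (by norm_num) (by norm_num)
      have hnn : 0 ≤ δ * (1 - (1 / 2) ^ n) := mul_nonneg hδ.le (by linarith)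
      rcases lt_trichotomy (binaryCode A) (binaryCode D) with hlt | heq | hlt
      · refine ⟨fun h => absurd (binaryCode_le h.1) hlt.not_ge, fun _ => ?_⟩
        rw [((hfgx D hD).2.2.1 A hlt).1, abs_zero]
        exact hnn
      · have hAD : A = D := by
          rw [← equivBitIndices_binaryCode A, heq, equivBitIndices_binaryCode]
        subst hAD
        refine ⟨fun _ => ?_, fun h => absurd (IsInitSeg.refl _) h⟩
        have := ((hfgx A hA).2.2.2.2 hDne).1
        linarith
      · have hAne : A.Nonempty := by
          rw [Finset.nonempty_iff_ne_empty]
          rintro rfl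
          simp [binaryCode] at hlt
        have hDA : D ≠ A := by rintro rfl; exact lt_irrefl _ hlt
        have hstep := abs_le.1 (((hfgx A hA).2.2.2.2 hAne).2 D hlt)
        have hpi := endPred_isInitSeg A
        have hpn : binaryCode (endPred A) < n := hAn ▸ binaryCode_lt hpi.1 (endPred_ne hAne)
        obtain ⟨i1, i2⟩ := ih _ hpn (endPred A) rfl (hT A hA _ hpi.1) D hD hDne
        have hp2 : 2 * (1 / 2 : ℝ) ^ n ≤ (1 / 2) ^ binaryCode (endPred A) := by
          obtain ⟨k, rfl⟩ : ∃ k, n = k + 1 := ⟨n - 1, by omega⟩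
          have : (1 / 2 : ℝ) ^ k ≤ (1 / 2) ^ binaryCode (endPred A) :=
            pow_le_pow_of_le_one (by norm_num) (by norm_num) (by omega)
          rw [pow_succ]
          linarith
        have hp3 := mul_le_mul_of_nonneg_left hp2 hδ.le
        rw [hAn] at hstep
        refine ⟨fun h => ?_, fun h => abs_le.2 ?_⟩
        · have := i1 (isInitSeg_endPred h hDA)
          linarith [hstep.1]
        · have := abs_le.1 (i2 fun h' => h (h'.trans hpi))
          constructor <;> linarith [hstep.1, hstep.2, this.1, this.2]
  refine ⟨f, x, ε / 8, by positivity, fun A hA => (hfgx A hA).1, fun A hA => (hfgx A hA).2.1,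
    fun A hA D hD hDne => ?_⟩
  obtain ⟨k1, k2⟩ := key _ A rfl hA D hD hDne
  have hpow : 0 < δ * (1 / 2 : ℝ) ^ binaryCode A := by positivity
  rcases lt_or_ge (binaryCode A) (binaryCode D) with hlt | hle
  · refine ⟨fun h => absurd (binaryCode_le h.1) hlt.not_ge, fun _ => ?_⟩
    rw [((hfgx D hD).2.2.1 A hlt).2]
    positivity
  · have happ := abs_le.1 ((hfgx A hA).2.2.2.1 D hle)
    refine ⟨fun h => ?_, fun h => ?_⟩
    · have := k1 h
      linarith [happ.1]
    · have := abs_le.1 (k2 h)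
      linarith [happ.2, this.2]

/-! ### The embedding theorem. -/

theorem theoremB {X : Type*} [NormedAddCommGroup X] [NormedSpace ℝ X] [CompleteSpace X]
    [TopologicalSpace.SeparableSpace X]
    (lam : Ordinal.{0} → ℕ → Ordinal.{0}) (hlam : IsApproxSystem lam)
    (α : Ordinal.{0}) (hα : α < ω_ 1)
    (hSz : ω ^ α < max (szlenkIndex X) (szlenkIndex (StrongDual ℝ X))) :
    SchreierBiLipschitzEmbeds lam α X ∧
      SchreierBiLipschitzEmbeds lam α (StrongDual ℝ X) := by
  have hS := isSchreierLike_schreier hlam α hα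
  have hR := hasRank_schreier hlam α hα
  have hJ : ∀ u : X, ‖u‖ ≤ 1 → ‖NormedSpace.inclusionInDoubleDual ℝ X u‖ ≤ 1 := fun u hu =>
    (NormedSpace.double_dual_bound ℝ X u).trans hu
  rcases lt_max_iff.1 hSz with h | h
  -- For `Sz(X)` large the functionals already lie in `X*`, so the whole dual ball is allowed. The
  -- points `x` embed the tree into `X`; the functionals `f`, tested by the images of the points in
  -- the bidual, embed it into `X*`.
  · obtain ⟨f, x, c, hc, hf, hx, hfx⟩ := exists_almost_triangular
      (W := {f : StrongDual ℝ X | ‖f‖ ≤ 1}) 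
      (fun g hg s δ hδ => ⟨g, hg, by simpa using fun _ _ => hδ.le⟩) hS.down hR h
    exact ⟨schreierBiLipschitzEmbeds_of_upper hlam hα x f hc one_pos hx hf
        (fun A hA D hD hne => (hfx A hA D hD hne).1) fun A hA D hD hne => (hfx A hA D hD hne).2,
      schreierBiLipschitzEmbeds_of_lower hlam hα f
        (fun D => NormedSpace.inclusionInDoubleDual ℝ X (x D)) hc one_pos hf
        (fun D hD => hJ _ (hx D hD))
        (fun A hA D hD hne => (hfx A hA D hD hne).1) fun A hA D hD hne => (hfx A hA D hD hne).2⟩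
  -- For `Sz(X*)` large the functionals are taken from the image of the ball of `X`, weak-* dense by
  -- Goldstine's theorem. The roles are reversed: `x` lies in `X*`, and the representatives `u` of
  -- the functionals give the vectors in `X`.
  · obtain ⟨f, x, c, hc, hf, hx, hfx⟩ := exists_almost_triangular
      (W := {f | ∃ u : X, ‖u‖ ≤ 1 ∧ f = NormedSpace.inclusionInDoubleDual ℝ X u})
      (fun g hg s δ hδ => by
        obtain ⟨u, hu, h⟩ := exists_norm_le_one_forall_abs_sub_le g hg s hδ
        exact ⟨_, ⟨u, hu, rfl⟩, h⟩) hS.down hR h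
    choose! u hu hfu using hf
    have hux : ∀ A ∈ schreier lam α, ∀ z : StrongDual ℝ X, z (u A) = f A z := fun A hA z => by
      rw [hfu A hA]; rfl
    refine ⟨schreierBiLipschitzEmbeds_of_lower hlam hα u x hc one_pos hu hx
        (fun A hA D hD hne hi => ?_) fun A hA D hD hne hi => ?_,
      schreierBiLipschitzEmbeds_of_upper hlam hα x f hc one_pos hx
        (fun A hA => by rw [hfu A hA]; exact hJ _ (hu A hA))
        (fun A hA D hD hne => (hfx A hA D hD hne).1) fun A hA D hD hne => (hfx A hA D hD hne).2⟩
    · rw [hux A hA]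
      exact (hfx A hA D hD hne).1 hi
    · rw [hux A hA]
      exact (hfx A hA D hD hne).2 hi
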